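/- **Setting.** Let $\mathcal V$ be a finite set of nodes, $\mathcal E\subset 2^{\mathcal V}$ a set of hyperedges containing $\emptyset$ and all singletons, and $\mathcal X_s$ a finite non-empty set of labels for each $s\in\mathcal V$. Put $\mathcal X_c=\prod_{s\in c}\mathcal X_s$, $\mathcal X=\mathcal X_{\mathcal V}$, $\mathcal I=\{(c,x_c): c\in\mathcal E,\ x_c\in\mathcal X_c\}$, and $\delta:\mathcal X\to\mathbb R^{\mathcal I}$, $\delta(x)_c(x'_c)=[\![x_c=x'_c]\!]$. Let $\mathcal M$ be the convex hull of $\delta(\mathcal X)$, let $A\in\mathbb R^{m\times\mathcal I}$, and let $$\Lambda=\{\mu\in\mathbb R^{\mathcal I}: A\mu\ge 0,\ \mu_\emptyset=1,\ \mu\ge 0\}$$ be bounded with $\mathcal M\subset\Lambda$. Assume moreover that the unary marginals are normalized: $\sum_{i\in\mathcal X_s}\mu_s(i)=1$ for all $\mu\in\Lambda$, $s\in\mathcal V$. Let $f\in\mathbb R^{\mathcal I}$. For a node-wise map $p(x)_s=p_s(x_s)$, with $p_s:\mathcal X_s\to\mathcal X_s$, let $[p]:\mathbb R^{\mathcal I}\to\mathbb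 R^{\mathcal I}$ be the linear map $([p]\mu)_c(x_c)=\sum_{x'_c}\prod_{s\in c}[\![p_s(x'_s)=x_s]\!]\,\mu_c(x'_c)$. Let $\mathbb S_f$ be the set of linear maps $P$ with $\langle f,P\mu\rangle<\langle f,\mu\rangle$ for all $\mu\in\Lambda$ with $P\mu\ne\mu$. For $y\in\mathcal X$, $\mathcal P^{1,y}$ is the set of maps $x\mapsto x[\mathcal A\leftarrow y]$ (overwrite $x$ by $y$ on $\mathcal A$), $\mathcal A\subset\mathcal V$, and $\mathcal P^1=\bigcup_y\mathcal P^{1,y}$. For a class $\mathcal C$ of node-wise maps, (MAX-SI) over $\mathcal C$ is the problem $$\max_{p\in\mathcal C}\ \sum_{s}\sum_{i\in\mathcal X_s}[\![p_s(i)\ne i]\!]\quad\text{s.t. } [p]\in\mathbb S_f .$$ **Linear program (L1) over $\mathcal P^{1,y}$.** The variables are $\varphi\in\mathbb R^m$, $\Phi\in\mathbb R^{m\times m}$ and $\zeta=(\zeta_{d,x_d})$, for $d$ contained in some hyperedge and $x_d\in\mathcal X_d$. Let $Z$ be the set of $\zeta$ with $\zeta_\emptyset=1$, with $\zeta_{d,x_d}=0$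 whenever $x_s=y_s$ for some $s\in d$, and with $\sum_{d\subset c\setminus b}(-1)^{|d|}\zeta_{d\cup b,x_{d\cup b}}\ge0$ for all $c\in\mathcal E$, $x_c\in\mathcal X_c$, $b\subset c$. Let $P_\zeta$ be the linear map $(P_\zeta\mu)_c(x_c)=\sum_{x'_c}(P_\zeta)_{c,x_c,x'_c}\,\mu_c(x'_c)$, where $(P_\zeta)_{c,x_c,x'_c}$ is obtained by expanding $$\prod_{s\in c}\big(([\![x'_s=x_s]\!]-[\![y_s=x_s]\!])\,\zeta_{s,x'_s}+[\![y_s=x_s]\!]\big)$$ and replacing each product $\prod_{s\in d}\zeta_{s,x'_s}$ by $\zeta_{d,x'_d}$. For a cost vector $\tilde f$, (L1) over $\mathcal P^{1,y}$ minimizes $\sum_{s,i}\zeta_{s,i}$ subject to $$(I-P_\zeta^{\mathsf T})\tilde f-A^{\mathsf T}\varphi\ge0,\quad \varphi\ge0,\quad AP_\zeta-\Phi^{\mathsf T}A\ge0,\quad \Phi\ge0,\quad \zeta\in Z,$$ and, for each $s$, equality of all $\zeta_{s,i}$ with $i\ne y_s$. An integral $\zeta$ represents the map $p_\zeta$ with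 $p_\zeta(x)_s=y_s$ if $\zeta_{s,x_s}=0$ and $p_\zeta(x)_s=x_s$ otherwise. **Two-phase method.** (1) Choose $\mu\in\operatorname{argmin}_{\mu\in\Lambda}\langle f,\mu\rangle$. (2) For each $s$, if $\mu_s(i)=1$ for some $i$, set $y_s=i$; otherwise choose $y_s$ arbitrarily. (3) Set $\tilde f=f+\varepsilon g$ with $g_c(x_c)=\sum_{s\in c}[\![x_s=y_s]\!]$. (4) Solve (L1) over $\mathcal P^{1,y}$ with costs $\tilde f$ and return $p_\zeta$. **Theorem.** The minimum in step (1) is attained, and there is $\varepsilon_0>0$ (depending only on the instance $(\mathcal V,\mathcal E,\mathcal X,A,f)$) such that for every $0<\varepsilon\le\varepsilon_0$ and all choices of $\mu$ and $y$ allowed in steps (1) and (2), the program in step (4) has an optimal solution, and for every optimal solution $(\zeta,\varphi,\Phi)$ the vector $\zeta$ is $\{0,1\}$-valued and $p_\zeta$ is an optimal solution of (MAX-SI) over the class of those $p\in\mathcal P^1$ that satisfy $[p](\Lambda)\subset\Lambda$. In particular, if $[p](\Lambda)\subset\Lambda$ for every $p\in\mathcal P^1$, then $p_\zeta$ is an optimal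 solution of (MAX-SI) over $\mathcal P^1$. This conclusion holds without that condition whenever $\Lambda$ is a local polytope, i.e. $\Lambda=\{\mu:\mu_\emptyset=1,\ \mu\ge0,\ \sum_{x_{c\setminus d}}\mu_c(x_c)=\mu_d(x_d)\ \text{for all } x_d\in\mathcal X_d \text{ and all } (d,c)\in J\}$ for some set $J$ of pairs $d\subset c$ of hyperedges. -/

import Mathlib

open scoped Matrix

namespace MaxPersistency

/-- A hypergraph on the node set `V` whose hyperedges include the empty set and all singletons. -/
structure EnergyHypergraph (V : Type*) [DecidableEq V] where
  edges : Finset (Finset V)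
  empty_mem : ∅ ∈ edges
  singleton_mem : ∀ s : V, {s} ∈ edges

section Basic

variable {V : Type*} [DecidableEq V] (H : EnergyHypergraph V) (X : V → Type*)

/-- The set of partial labelings `X_c = ∏_{s ∈ c} X_s`. -/
abbrev PartialLabeling (c : Finset V) : Type _ := (s : c) → X s.1

/-- The index set `I` of pairs `(c, x_c)`, with `c` a hyperedge and `x_c ∈ X_c`. -/
abbrev Idx : Type _ := (c : H.edges) × PartialLabeling X c.1

variable {X}

/-- A single label `i ∈ X_s`, seen as an element of `X_{{s}}`. -/
def single (s : V) (i : X s) : PartialLabeling X {s} :=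
  fun t => (Finset.mem_singleton.1 t.2).symm ▸ i

/-- The index of the constant component. -/
def emptyIdx : Idx H X := ⟨⟨∅, H.empty_mem⟩, fun s => absurd s.2 (Finset.notMem_empty s.1)⟩

/-- The index of the unary component `(s, i)`. -/
def nodeIdx (s : V) (i : X s) : Idx H X := ⟨⟨{s}, H.singleton_mem s⟩, single s i⟩

variable [∀ s, DecidableEq (X s)]

/-- The embedding `δ(x)_c(x'_c) = ⟦x_c = x'_c⟧` of labelings into `ℝ^I`. -/
def embed (x : (s : V) → X s) : Idx H X → ℝ :=
  fun i => if i.1.1.restrict x = i.2 then 1 else 0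

/-- The marginal polytope, the convex hull of all embedded labelings. -/
def marginalPolytope : Set (Idx H X → ℝ) := convexHull ℝ (Set.range (embed H (X := X)))

variable [∀ s, Fintype (X s)]

/-- The polytope `Λ = {μ | A μ ≥ 0, μ_∅ = 1, μ ≥ 0}`. -/
def relaxation {m : ℕ} (A : Matrix (Fin m) (Idx H X) ℝ) : Set (Idx H X → ℝ) :=
  {μ | (∀ j, 0 ≤ (A *ᵥ μ) j) ∧ μ (emptyIdx H) = 1 ∧ ∀ i, 0 ≤ μ i}

/-- The local polytope of a coupling structure `J`: the marginalization constraint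
`∑_{x_{c \ d}} μ_c(x_c) = μ_d(x_d)` is imposed for the pairs `d ⊆ c` selected by `J`. -/
def localPolytope (J : H.edges → H.edges → Prop) : Set (Idx H X → ℝ) :=
  {μ | (∀ d c : H.edges, J d c → ∀ h : d.1 ⊆ c.1, ∀ xd : PartialLabeling X d.1,
      (∑ xc : PartialLabeling X c.1, if Finset.restrict₂ h xc = xd then μ ⟨c, xc⟩ else 0)
        = μ ⟨d, xd⟩) ∧
    μ (emptyIdx H) = 1 ∧ ∀ i, 0 ≤ μ i}

/-- The set of minimizers of `⟨f, μ⟩` over `Λ`. -/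
def argminOver (Λ : Set (Idx H X → ℝ)) (f : Idx H X → ℝ) : Set (Idx H X → ℝ) :=
  {μ | μ ∈ Λ ∧ ∀ ν ∈ Λ, f ⬝ᵥ μ ≤ f ⬝ᵥ ν}

/-- The linear extension `[p]` of a node-wise map `p`, as a matrix with entries
`∏_{s ∈ c} ⟦p_s(x'_s) = x_s⟧` in the diagonal blocks. -/
def linExt (p : (s : V) → X s → X s) : Matrix (Idx H X) (Idx H X) ℝ :=
  Matrix.blockDiagonal' fun c : H.edges => Matrix.of fun x x' : PartialLabeling X c.1 =>
    ∏ s : c.1, if p s.1 (x' s) = x s then (1 : ℝ) else 0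

/-- The set `S_f` of strict `Λ`-improving linear maps for `f`. -/
def strictImproving (Λ : Set (Idx H X → ℝ)) (f : Idx H X → ℝ) :
    Set (Matrix (Idx H X) (Idx H X) ℝ) :=
  {P | ∀ μ ∈ Λ, P *ᵥ μ ≠ μ → f ⬝ᵥ (P *ᵥ μ) < f ⬝ᵥ μ}

/-- The node-wise maps `p` with `[p](Λ) ⊆ Λ`. -/
def preserving (Λ : Set (Idx H X → ℝ)) : Set ((s : V) → X s → X s) :=
  {p | ∀ μ ∈ Λ, linExt H p *ᵥ μ ∈ Λ}

/-- The all-to-one maps `x ↦ x[𝒜 ← y]` for a fixed labeling `y`. -/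
def allToOne (y : (s : V) → X s) : Set ((s : V) → X s → X s) :=
  {p | ∃ 𝒜 : Finset V, p = fun s i => if s ∈ 𝒜 then y s else i}

/-- The all-to-one maps with unknown target labeling. -/
def allToOneUnknown : Set ((s : V) → X s → X s) :=
  ⋃ y : (s : V) → X s, allToOne y

/-- The number of labels `(s, i)` eliminated by a node-wise map. -/
def eliminated [Fintype V] (p : (s : V) → X s → X s) : ℕ :=
  ∑ s, ∑ i, if p s i ≠ i then 1 else 0

/-- `p` is an optimal solution of (MAX-SI) over the class `C` of node-wise maps:
maximize the number of eliminated labels over `p ∈ C` with `[p] ∈ S_f`. -/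
def IsMaxSI [Fintype V] (Λ : Set (Idx H X → ℝ)) (f : Idx H X → ℝ)
    (C : Set ((s : V) → X s → X s)) (p : (s : V) → X s → X s) : Prop :=
  (p ∈ C ∧ linExt H p ∈ strictImproving H Λ f) ∧
    ∀ q ∈ C, linExt H q ∈ strictImproving H Λ f → eliminated q ≤ eliminated p

/-- `y` is a test labeling for `μ`: `y_s = i` for some `i` with `μ_s(i) = 1` whenever there is
such an `i`, and `y_s` is arbitrary otherwise. -/
def IsTestLabeling (μ : Idx H X → ℝ) (y : (s : V) → X s) : Prop :=
  ∀ s, (∃ i, μ (nodeIdx H s i) = 1) → μ (nodeIdx H s (y s)) = 1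

/-- The perturbed costs `f + ε g` with `g_c(x_c) = ∑_{s ∈ c} ⟦x_s = y_s⟧`. -/
def perturb (f : Idx H X → ℝ) (y : (s : V) → X s) (ε : ℝ) : Idx H X → ℝ :=
  fun i => f i + ε * ∑ s : i.1.1, if i.2 s = y s.1 then (1 : ℝ) else 0

end Basic

section LinearProgram

variable {V : Type*} [DecidableEq V] (H : EnergyHypergraph V) {X : V → Type*}

/-- The Sherali-Adams polytope of a hyperedge `c`, in variables `z_d`, `d ⊆ c`. -/
def saPolytope (c : Finset V) : Set (Finset V → ℝ) :=
  {z | z ∅ = 1 ∧ ∀ b ⊆ c, 0 ≤ ∑ d ∈ (c \ b).powerset, (-1) ^ d.card * z (d ∪ b)}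

/-- For a vector of lifted variables `ζ_{d, x_d}` and a fixed `x_c`, the family
`(ζ_{d, x_d})_{d ⊆ c}` where `x_d` is the restriction of `x_c`. -/
def column (ζ : (d : Finset V) → PartialLabeling X d → ℝ) {c : Finset V}
    (x : PartialLabeling X c) : Finset V → ℝ :=
  fun d => if h : d ⊆ c then ζ d (Finset.restrict₂ h x) else 0

/-- The polytope of the lifted variables `ζ_{d, x_d}`, where `d` ranges over the subsets of
hyperedges; coordinates for other sets `d` do not exist in the program and are set to zero. -/
def zetaPolytope (y : (s : V) → X s) : Set ((d : Finset V) → PartialLabeling X d → ℝ) :=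
  {ζ | (∀ (d : Finset V) (x : PartialLabeling X d), (∀ c ∈ H.edges, ¬ d ⊆ c) → ζ d x = 0) ∧
    (∀ x, ζ ∅ x = 1) ∧
    (∀ (d : Finset V) (x : PartialLabeling X d), (∃ s : d, x s = y s.1) → ζ d x = 0) ∧
    ∀ c ∈ H.edges, ∀ x : PartialLabeling X c, column ζ x ∈ saPolytope c}

variable [∀ s, DecidableEq (X s)]

/-- The linearization `P_ζ` of `[p_ζ]`: the products `∏_{s ∈ d} ζ_{s, x'_s}` in the expansion of
`∏_{s ∈ c} ((⟦x'_s = x_s⟧ - ⟦y_s = x_s⟧) ζ_{s, x'_s} + ⟦y_s = x_s⟧)` are replaced by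
`ζ_{d, x'_d}`. -/
def linearization (y : (s : V) → X s) (ζ : (d : Finset V) → PartialLabeling X d → ℝ) :
    Matrix (Idx H X) (Idx H X) ℝ :=
  Matrix.blockDiagonal' fun c : H.edges => Matrix.of fun x x' : PartialLabeling X c.1 =>
    ∑ d ∈ c.1.powerset,
      (∏ s : c.1, if s.1 ∈ d
        then (if x' s = x s then (1 : ℝ) else 0) - (if y s.1 = x s then 1 else 0)
        else (if y s.1 = x s then 1 else 0)) * column ζ x' d

/-- The discrete map `p_ζ`: a label `i` of `s` is kept if `ζ_{s, i} ≠ 0` and is sent to `y_s` if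
`ζ_{s, i} = 0`. -/
noncomputable def roundMap (y : (s : V) → X s) (ζ : (d : Finset V) → PartialLabeling X d → ℝ) :
    (s : V) → X s → X s :=
  open Classical in fun s i => if ζ {s} (single s i) = 0 then y s else i

variable [∀ s, Fintype (X s)]

/-- Feasibility of `(ζ, φ, Φ)` for (L1) with costs `f`, polytope matrix `A` and class of
all-to-one maps with target `y`: for each node `s`, the unary variables `ζ_{s, i}`, `i ≠ y_s`,
are required to be equal. -/
structure L1Feasible {m : ℕ} (A : Matrix (Fin m) (Idx H X) ℝ) (f : Idx H X → ℝ)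
    (y : (s : V) → X s) (ζ : (d : Finset V) → PartialLabeling X d → ℝ) (φ : Fin m → ℝ)
    (Φ : Matrix (Fin m) (Fin m) ℝ) : Prop where
  improving : ∀ i, 0 ≤ (f - (linearization H y ζ)ᵀ *ᵥ f - Aᵀ *ᵥ φ) i
  multiplier_nonneg : ∀ j, 0 ≤ φ j
  closed : ∀ j i, 0 ≤ (A * linearization H y ζ - Φᵀ * A) j i
  closed_multiplier_nonneg : ∀ j k, 0 ≤ Φ j k
  mem_zeta : ζ ∈ zetaPolytope H y
  all_to_one : ∀ s i j, i ≠ y s → j ≠ y s → ζ {s} (single s i) = ζ {s} (single s j)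

/-- The objective `∑_{s, i} ζ_{s, i}` of (L1). -/
def l1Objective [Fintype V] (ζ : (d : Finset V) → PartialLabeling X d → ℝ) : ℝ :=
  ∑ s, ∑ i, ζ {s} (single s i)

/-- `(ζ, φ, Φ)` is an optimal solution of (L1) for the class of all-to-one maps with target
`y`. -/
def IsL1Solution [Fintype V] {m : ℕ} (A : Matrix (Fin m) (Idx H X) ℝ) (f : Idx H X → ℝ)
    (y : (s : V) → X s) (ζ : (d : Finset V) → PartialLabeling X d → ℝ) (φ : Fin m → ℝ)
    (Φ : Matrix (Fin m) (Fin m) ℝ) : Prop :=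
  L1Feasible H A f y ζ φ Φ ∧
    ∀ ζ' φ' Φ', L1Feasible H A f y ζ' φ' Φ' → l1Objective ζ ≤ l1Objective ζ'

end LinearProgram

end MaxPersistency

open MaxPersistency

/-! Möbius inversion turns the variables `ζ` at `x_c` into a probability distribution over the kept
subsets `e ⊆ c`; the column of `P_ζ` at `x_c` is the mixture of the labelings that agree with `x_c`
on `e` and with `y` elsewhere (`vecMul_linearization`). By Farkas, the multipliers of (L1) say
exactly that `P_ζ` maps `Λ` to itself and does not increase the cost there.

Rounding: let `Q` overwrite by `y` every node that `ζ` moves with positive probability. Then `Q P_ζ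
= Q`, and `P_ζ` decreases the discrepancy from `y` on these nodes. Minimizing the discrepancy over
the points of `Λ` that cost no more than `μ` and have the same image under `Q` yields a point fixed
by `Q`, hence equal to `Q μ`. So `Q` inherits both properties (`L1Feasible.overwrite_moved`), its
integral `ζ` is feasible, and it is termwise no larger: every optimum is integral.

The perturbation converts weak into strict improvement: an all-to-one map with target `y` raises
`⟨g, μ⟩` by the discrepancy, which vanishes only at fixed points. Conversely, Farkas bounds the
discrepancy by a multiple of a strict gain, so a small `ε` loses no strictly improving map. Finally,
a strictly improving map that preserves `Λ` must fix the minimizer `μ`, so its target agrees with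
`y` wherever it acts (`exists_eq_overwrite`). -/

namespace MaxPersistency

/-! ### Farkas' lemma -/

section Farkas

/-- **Farkas' lemma** for finitely many linear functionals on a real vector space. -/
theorem farkas_linearMap {E ι : Type*} [AddCommGroup E] [Module ℝ E] (s : Finset ι)
    (a : ι → E →ₗ[ℝ] ℝ) (b : E →ₗ[ℝ] ℝ)
    (h : ∀ x, (∀ i ∈ s, 0 ≤ a i x) → 0 ≤ b x) :
    ∃ c : ι → ℝ, (∀ i, 0 ≤ c i) ∧ b = ∑ i ∈ s, c i • a i := by
  classical
  induction s using Finset.induction_on generalizing a b with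
  | empty =>
    refine ⟨0, fun _ => le_rfl, ?_⟩
    ext x
    have h1 := h x (by simp)
    have h2 := h (-x) (by simp)
    simp only [map_neg] at h2
    simp only [Finset.sum_empty, LinearMap.zero_apply]
    linarith
  | insert k s hk ih =>
    by_cases hb : ∀ x, (∀ i ∈ s, 0 ≤ a i x) → 0 ≤ b x
    · obtain ⟨c, hc, rfl⟩ := ih a b hb
      refine ⟨fun i => if i = k then 0 else c i, fun i => ?_, ?_⟩
      · dsimp only
        split_ifs
        exacts [le_rfl, hc i]
      · rw [Finset.sum_insert hk]
        simp only [if_true, zero_smul, zero_add]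
        refine Finset.sum_congr rfl fun i hi => ?_
        rw [if_neg (ne_of_mem_of_not_mem hi hk)]
    · push Not at hb
      obtain ⟨x₀, hx₀, hbx₀⟩ := hb
      have hk₀ : a k x₀ < 0 := by
        by_contra hneg
        refine absurd (h x₀ fun i hi => ?_) (not_le.2 hbx₀)
        rcases Finset.mem_insert.1 hi with rfl | hi
        exacts [not_lt.1 hneg, hx₀ i hi]
      -- With this scaling `x ↦ x + (r * a k x) • x₀` projects onto the kernel of `a k`. The
      -- induction hypothesis is applied to the functionals composed with this projection.
      set r : ℝ := (-(a k x₀))⁻¹ with hr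
      have hrpos : 0 < r := inv_pos.2 (neg_pos.2 hk₀)
      have hrk : r * a k x₀ = -1 := by
        rw [hr, inv_neg, neg_mul, inv_mul_cancel₀ hk₀.ne]
      obtain ⟨c, hc, hbc⟩ := ih (fun i => a i + (r * a i x₀) • a k) (b + (r * b x₀) • a k) (by
        intro x hx
        have := h (x + (r * a k x) • x₀) (by
          intro i hi
          rcases Finset.mem_insert.1 hi with rfl | hi
          · simp only [map_add, map_smul, smul_eq_mul]
            have : r * a i x * a i x₀ = - a i x := by
              calc r * a i x * a i x₀ = (r * a i x₀) * a i x := by ring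
                _ = _ := by rw [hrk]; ring
            rw [this]; simp
          · have := hx i hi
            simp only [LinearMap.add_apply, LinearMap.smul_apply, smul_eq_mul] at this
            simp only [map_add, map_smul, smul_eq_mul]
            linarith)
        simp only [map_add, map_smul, smul_eq_mul] at this
        simp only [LinearMap.add_apply, LinearMap.smul_apply, smul_eq_mul]
        linarith)
      -- Undoing the projection leaves this coefficient on `a k`; it is nonnegative because `x₀`
      -- satisfies the constraints of `s` and violates `b`.
      have hck : 0 ≤ ∑ i ∈ s, c i * (r * a i x₀) - r * b x₀ := by
        have h1 : 0 ≤ ∑ i ∈ s, c i * (r * a i x₀) := Finset.sum_nonneg fun i hi =>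
          mul_nonneg (hc i) (mul_nonneg hrpos.le (hx₀ i hi))
        have h2 := mul_neg_of_pos_of_neg hrpos hbx₀
        linarith
      refine ⟨fun i => if i = k then ∑ i ∈ s, c i * (r * a i x₀) - r * b x₀ else c i,
        fun i => ?_, ?_⟩
      · dsimp only
        split_ifs
        exacts [hck, hc i]
      · rw [Finset.sum_insert hk]
        have h1 : ∑ i ∈ s, (if i = k then ∑ i ∈ s, c i * (r * a i x₀) - r * b x₀ else c i) • a i
            = ∑ i ∈ s, c i • a i :=
          Finset.sum_congr rfl fun i hi => by rw [if_neg (ne_of_mem_of_not_mem hi hk)]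
        rw [h1]
        simp only [if_true]
        ext x
        have h2 := congrArg (fun l => l x) hbc
        simp only [LinearMap.add_apply, LinearMap.smul_apply, smul_eq_mul, LinearMap.sum_apply,
          mul_add, Finset.sum_add_distrib] at h2 ⊢
        have h3 : ∑ i ∈ s, c i * (r * a i x₀ * a k x)
            = (∑ i ∈ s, c i * (r * a i x₀)) * a k x := by
          rw [Finset.sum_mul]
          exact Finset.sum_congr rfl fun i _ => by ring
        rw [h3] at h2
        linarith

/-- **Farkas' lemma** for the cone `{x | A x ≥ 0, x ≥ 0}`. -/
theorem farkas_matrix {κ ι : Type*} [Fintype κ] [Fintype ι] (A : Matrix κ ι ℝ) (v : ι → ℝ)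
    (h : ∀ x, (∀ j, 0 ≤ (A *ᵥ x) j) → (∀ i, 0 ≤ x i) → 0 ≤ v ⬝ᵥ x) :
    ∃ φ : κ → ℝ, (∀ j, 0 ≤ φ j) ∧ ∀ i, 0 ≤ (v - Aᵀ *ᵥ φ) i := by
  classical
  obtain ⟨c, hc, hv⟩ := farkas_linearMap (Finset.univ : Finset (κ ⊕ ι))
    (Sum.elim (fun j => (LinearMap.proj j).comp A.mulVecLin) LinearMap.proj)
    (dotProductBilin ℝ ℝ v) (fun x hx => h x
      (fun j => by simpa using hx (Sum.inl j) (Finset.mem_univ _))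
      (fun i => by simpa using hx (Sum.inr i) (Finset.mem_univ _)))
  refine ⟨fun j => c (Sum.inl j), fun j => hc _, fun i => ?_⟩
  have h1 := congrArg (fun l => l (Pi.single i 1)) hv
  simp only [Fintype.sum_sum_type, LinearMap.add_apply, LinearMap.sum_apply,
    LinearMap.smul_apply, Sum.elim_inl, Sum.elim_inr, LinearMap.comp_apply, LinearMap.proj_apply,
    Matrix.mulVecLin_apply, Matrix.mulVec_single_one, Matrix.col_apply, smul_eq_mul] at h1
  have h2 : ∑ j, c (Sum.inr j) * (Pi.single i (1 : ℝ) : ι → ℝ) j = c (Sum.inr i) := by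
    simp [Pi.single_apply]
  have h3 : dotProductBilin ℝ ℝ v (Pi.single i 1) = v i := by simp
  rw [h2, h3] at h1
  have h4 : (Aᵀ *ᵥ fun j => c (Sum.inl j)) i = ∑ j, c (Sum.inl j) * A j i := by
    simp only [Matrix.mulVec, dotProduct, Matrix.transpose_apply]
    exact Finset.sum_congr rfl fun j _ => mul_comm _ _
  rw [Pi.sub_apply, h4, h1]
  have := hc (Sum.inr i)
  linarith

end Farkas

/-! ### Möbius inversion on the Sherali-Adams polytope -/

section Weights

variable {V : Type*} [DecidableEq V]

/-- The Möbius transform of a vector `z` of the Sherali-Adams polytope of `c`: the probability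
that exactly the nodes of `e` are kept. -/
def weight (z : Finset V → ℝ) (c e : Finset V) : ℝ :=
  ∑ d ∈ (c \ e).powerset, (-1) ^ d.card * z (d ∪ e)

/-- In the probabilistic reading, the event that `s` is dropped is the complement of the event that
it is kept. With `weight_insert_insert` this gives a recursion on `c`. -/
theorem weight_insert_of_notMem (z : Finset V → ℝ) {c e : Finset V} {s : V} (hc : s ∉ c)
    (he : s ∉ e) :
    weight z (insert s c) e = weight z c e - weight (fun d => z (insert s d)) c e := by
  have h : s ∉ c \ e := fun h => hc (Finset.mem_sdiff.1 h).1
  rw [weight, Finset.insert_sdiff_of_notMem _ he, Finset.sum_powerset_insert h, sub_eq_add_neg,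
    weight, weight, ← Finset.sum_neg_distrib]
  congr 1
  refine Finset.sum_congr rfl fun d hd => ?_
  rw [Finset.card_insert_of_notMem fun hs => h (Finset.mem_powerset.1 hd hs), Finset.insert_union]
  ring

theorem weight_insert_insert (z : Finset V → ℝ) {c e : Finset V} {s : V} (hc : s ∉ c) :
    weight z (insert s c) (insert s e) = weight (fun d => z (insert s d)) c e := by
  have h : insert s c \ insert s e = c \ e := by
    ext t
    simp only [Finset.mem_sdiff, Finset.mem_insert]
    constructor
    · rintro ⟨rfl | h, h'⟩
      · exact absurd (Or.inl rfl) h'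
      · exact ⟨h, fun h'' => h' (Or.inr h'')⟩
    · rintro ⟨h, h'⟩
      refine ⟨Or.inr h, ?_⟩
      rintro (rfl | h'')
      exacts [hc h, h' h'']
  rw [weight, h, weight]
  simp only [Finset.union_insert]

/-- Expanding a linearized product in terms of the Möbius transform. -/
theorem sum_powerset_prod_sub (c : Finset V) (a b : V → ℝ) (z : Finset V → ℝ) :
    ∑ d ∈ c.powerset, (∏ s ∈ c, if s ∈ d then a s - b s else b s) * z d
      = ∑ e ∈ c.powerset, (∏ s ∈ c, if s ∈ e then a s else b s) * weight z c e := by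
  induction c using Finset.induction_on generalizing z with
  | empty => simp [weight]
  | insert s c hs ih =>
    have key : ∀ (a' : V → ℝ) (d : Finset V), d ∈ c.powerset →
        (∏ t ∈ insert s c, if t ∈ d then a' t else b t)
          = b s * ∏ t ∈ c, if t ∈ d then a' t else b t := by
      intro a' d hd
      rw [Finset.prod_insert hs, if_neg fun h => hs (Finset.mem_powerset.1 hd h)]
    have key' : ∀ (a' : V → ℝ) (d : Finset V),
        (∏ t ∈ insert s c, if t ∈ insert s d then a' t else b t)
          = a' s * ∏ t ∈ c, if t ∈ d then a' t else b t := by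
      intro a' d
      rw [Finset.prod_insert hs, if_pos (Finset.mem_insert_self _ _)]
      congr 1
      refine Finset.prod_congr rfl fun t ht => ?_
      have : t ≠ s := fun h => hs (h ▸ ht)
      simp [Finset.mem_insert, this]
    rw [Finset.sum_powerset_insert hs, Finset.sum_powerset_insert hs]
    have e1 : ∑ d ∈ c.powerset, (∏ t ∈ insert s c, if t ∈ d then a t - b t else b t) * z d
        = b s * ∑ e ∈ c.powerset, (∏ t ∈ c, if t ∈ e then a t else b t) * weight z c e := by
      rw [← ih, Finset.mul_sum]
      exact Finset.sum_congr rfl fun d hd => by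
        rw [key (fun t => a t - b t) d hd]; ring
    have e2 : ∑ d ∈ c.powerset,
        (∏ t ∈ insert s c, if t ∈ insert s d then a t - b t else b t) * z (insert s d)
        = (a s - b s) * ∑ e ∈ c.powerset, (∏ t ∈ c, if t ∈ e then a t else b t)
            * weight (fun d => z (insert s d)) c e := by
      rw [← ih, Finset.mul_sum]
      exact Finset.sum_congr rfl fun d hd => by
        rw [key' (fun t => a t - b t) d]; ring
    rw [e1, e2, Finset.mul_sum, Finset.mul_sum, ← Finset.sum_add_distrib,
      ← Finset.sum_add_distrib]
    refine Finset.sum_congr rfl fun e he => ?_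
    rw [key a e he, key' a e, weight_insert_insert z hs,
      weight_insert_of_notMem z hs fun h => hs (Finset.mem_powerset.1 he h)]
    ring

/-- Möbius inversion. -/
theorem sum_weight_superset (z : Finset V → ℝ) {c d : Finset V} (hd : d ⊆ c) :
    ∑ e ∈ c.powerset, (if d ⊆ e then weight z c e else 0) = z d := by
  -- For this choice the product on the left is the indicator of `d' = d`, and the one on the right
  -- the indicator of `d ⊆ e`.
  have h := sum_powerset_prod_sub c (fun _ => 1) (fun s => if s ∈ d then 0 else 1) z
  have e1 : ∑ d' ∈ c.powerset, (∏ s ∈ c, if s ∈ d' then (1 : ℝ) - (if s ∈ d then 0 else 1)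
      else (if s ∈ d then 0 else 1)) * z d' = z d := by
    rw [Finset.sum_eq_single_of_mem d (Finset.mem_powerset.2 hd)]
    · rw [Finset.prod_eq_one, one_mul]
      intro s _
      by_cases hs : s ∈ d <;> simp [hs]
    · intro d' hd' hne
      have : ∃ s ∈ c, ¬ (s ∈ d' ↔ s ∈ d) := by
        by_contra! hcon
        refine hne (Finset.ext fun s => ⟨fun h => ?_, fun h => ?_⟩)
        · exact (hcon s (Finset.mem_powerset.1 hd' h)).1 h
        · exact (hcon s (hd h)).2 h
      obtain ⟨s, hsc, hs⟩ := this
      rw [Finset.prod_eq_zero hsc, zero_mul]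
      by_cases h1 : s ∈ d' <;> by_cases h2 : s ∈ d <;> simp_all
  rw [e1] at h
  rw [h]
  refine Finset.sum_congr rfl fun e _ => ?_
  by_cases hde : d ⊆ e
  · rw [if_pos hde, Finset.prod_eq_one, one_mul]
    intro s _
    by_cases hs : s ∈ e
    · simp [hs]
    · simp [hs, show s ∉ d from fun h => hs (hde h)]
  · rw [if_neg hde]
    obtain ⟨s, hsd, hse⟩ := Finset.not_subset.1 hde
    rw [Finset.prod_eq_zero (hd hsd), zero_mul]
    simp [hse, hsd]

variable {z : Finset V → ℝ} {c d : Finset V}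

theorem weight_nonneg (hz : z ∈ saPolytope c) {e : Finset V} (he : e ∈ c.powerset) :
    0 ≤ weight z c e :=
  hz.2 e (Finset.mem_powerset.1 he)

theorem sum_weight (hz : z ∈ saPolytope c) : ∑ e ∈ c.powerset, weight z c e = 1 := by
  rw [← hz.1, ← sum_weight_superset z (Finset.empty_subset c)]
  simp

/-- If `z_s = 1`, then `s` is kept almost surely. -/
theorem weight_eq_zero_of_eq_one (hz : z ∈ saPolytope c) {s : V} (hs : s ∈ c)
    (h1 : z {s} = 1) {e : Finset V} (he : e ∈ c.powerset) (hse : s ∉ e) : weight z c e = 0 := by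
  have h : ∑ e ∈ c.powerset, (if s ∈ e then 0 else weight z c e) = 0 := by
    have h2 := sum_weight_superset z (Finset.singleton_subset_iff.2 hs)
    have h3 := sum_weight hz
    have h4 : ∑ e ∈ c.powerset, (if s ∈ e then 0 else weight z c e)
        = ∑ e ∈ c.powerset, weight z c e
          - ∑ e ∈ c.powerset, (if {s} ⊆ e then weight z c e else 0) := by
      rw [← Finset.sum_sub_distrib]
      refine Finset.sum_congr rfl fun e _ => ?_
      by_cases hs : s ∈ e <;> simp [hs]
    rw [h4, h2, h3, h1, sub_self]
  rw [Finset.sum_eq_zero_iff_of_nonneg] at h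
  · simpa [hse] using h e he
  · intro e he
    split_ifs
    exacts [le_rfl, weight_nonneg hz he]

/-- If `s` is kept almost surely, then `z_s = 1`. -/
theorem eq_one_of_weight_eq_zero (hz : z ∈ saPolytope c) {s : V} (hs : s ∈ c)
    (h : ∀ e ∈ c.powerset, s ∉ e → weight z c e = 0) : z {s} = 1 := by
  rw [← sum_weight_superset z (Finset.singleton_subset_iff.2 hs), ← sum_weight hz]
  refine Finset.sum_congr rfl fun e he => ?_
  by_cases hse : s ∈ e
  · simp [hse]
  · simp [hse, h e he hse]

/-- By inversion `z d` is the probability that all of `d` is kept; this also explains the next two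
lemmas. -/
theorem saPolytope_nonneg (hz : z ∈ saPolytope c) (hd : d ⊆ c) : 0 ≤ z d := by
  rw [← sum_weight_superset z hd]
  refine Finset.sum_nonneg fun e he => ?_
  split_ifs
  exacts [weight_nonneg hz he, le_rfl]

theorem saPolytope_eq_zero (hz : z ∈ saPolytope c) (hd : d ⊆ c) {s : V} (hs : s ∈ d)
    (h0 : z {s} = 0) : z d = 0 := by
  refine le_antisymm ?_ (saPolytope_nonneg hz hd)
  rw [← h0, ← sum_weight_superset z hd,
    ← sum_weight_superset z (Finset.singleton_subset_iff.2 (hd hs))]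
  refine Finset.sum_le_sum fun e he => ?_
  by_cases hde : d ⊆ e
  · rw [if_pos hde, if_pos (Finset.singleton_subset_iff.2 (hde hs))]
  · rw [if_neg hde]
    split_ifs
    exacts [weight_nonneg hz he, le_rfl]

theorem saPolytope_eq_one (hz : z ∈ saPolytope c) (hd : d ⊆ c)
    (h1 : ∀ s ∈ d, z {s} = 1) : z d = 1 := by
  rw [← sum_weight_superset z hd, ← sum_weight hz]
  refine Finset.sum_congr rfl fun e he => ?_
  by_cases hde : d ⊆ e
  · rw [if_pos hde]
  · obtain ⟨s, hsd, hse⟩ := Finset.not_subset.1 hde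
    rw [if_neg hde, weight_eq_zero_of_eq_one hz (hd hsd) (h1 s hsd) he hse]

/-- The Möbius transform of the indicator of the subsets of `k` is concentrated at `k`. -/
theorem weight_indicator {k : Finset V} (hz : ∀ d ⊆ c, z d = if d ⊆ k then 1 else 0)
    (hk : k ⊆ c) {e : Finset V} (he : e ⊆ c) : weight z c e = if e = k then 1 else 0 := by
  have h1 : weight z c e = ∑ d ∈ (c \ e).powerset,
      if d ⊆ k \ e then (if e ⊆ k then (-1 : ℝ) ^ d.card else 0) else 0 := by
    refine Finset.sum_congr rfl fun d hd => ?_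
    rw [Finset.mem_powerset] at hd
    rw [hz _ (Finset.union_subset (hd.trans Finset.sdiff_subset) he)]
    simp only [Finset.union_subset_iff]
    have : d ⊆ k \ e ↔ d ⊆ k :=
      ⟨fun h => h.trans Finset.sdiff_subset,
        fun h s hs => Finset.mem_sdiff.2 ⟨h hs, (Finset.mem_sdiff.1 (hd hs)).2⟩⟩
    simp only [this]
    by_cases h1 : d ⊆ k <;> by_cases h2 : e ⊆ k <;> simp [h1, h2]
  rw [h1, ← Finset.sum_filter]
  have h2 : (c \ e).powerset.filter (· ⊆ k \ e) = (k \ e).powerset := by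
    ext d
    simp only [Finset.mem_filter, Finset.mem_powerset]
    exact ⟨fun h => h.2, fun h => ⟨h.trans (Finset.sdiff_subset_sdiff hk le_rfl), h⟩⟩
  rw [h2]
  by_cases hek : e ⊆ k
  · simp only [if_pos hek]
    -- The alternating sum over subsets of `k \ e` vanishes unless `k ⊆ e`.
    have h3 := Finset.sum_powerset_neg_one_pow_card (x := k \ e)
    have h4 : ∑ d ∈ (k \ e).powerset, (-1 : ℝ) ^ d.card = if k \ e = ∅ then 1 else 0 := by
      have := congrArg (Int.cast : ℤ → ℝ) h3
      push_cast at this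
      exact this
    rw [h4]
    refine if_congr ?_ rfl rfl
    rw [Finset.sdiff_eq_empty_iff_subset]
    exact ⟨fun h => subset_antisymm hek h, fun h => h ▸ subset_rfl⟩
  · simp only [if_neg hek, Finset.sum_const_zero]
    rw [if_neg]
    rintro rfl
    exact hek subset_rfl

end Weights

/-! ### The matrices `P_ζ` and `[p]` acting on row vectors -/

section Action

theorem vecMul_blockDiagonal'_apply {o : Type*} [Fintype o] [DecidableEq o] {n : o → Type*}
    [∀ c, Fintype (n c)] (M : ∀ c, Matrix (n c) (n c) ℝ) (F : (Σ c, n c) → ℝ) (c : o) (x : n c) :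
    (F ᵥ* Matrix.blockDiagonal' M) ⟨c, x⟩ = ∑ x', F ⟨c, x'⟩ * M c x' x := by
  simp only [Matrix.vecMul, dotProduct, Fintype.sum_sigma]
  rw [Finset.sum_eq_single_of_mem c (Finset.mem_univ c)]
  · simp only [Matrix.blockDiagonal'_apply_eq]
  · intro c' _ hne
    refine Finset.sum_eq_zero fun x' _ => ?_
    rw [Matrix.blockDiagonal'_apply_ne _ _ _ hne, mul_zero]

variable {V : Type*} [DecidableEq V] (H : EnergyHypergraph V) {X : V → Type*}

/-- The labeling that agrees with `x` on `e` and with `y` elsewhere. -/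
def mix (y : (s : V) → X s) (e : Finset V) {c : Finset V} (x : PartialLabeling X c) :
    PartialLabeling X c :=
  fun s => if s.1 ∈ e then x s else y s.1

/-- The all-to-one map `x ↦ x[𝒜 ← y]`. -/
def overwrite (y : (s : V) → X s) (𝒜 : Finset V) : (s : V) → X s → X s :=
  fun s i => if s ∈ 𝒜 then y s else i

theorem column_singleton (ζ : (d : Finset V) → PartialLabeling X d → ℝ) {c : Finset V}
    (x : PartialLabeling X c) (s : c) : column ζ x {s.1} = ζ {s.1} (single s.1 (x s)) := by
  rw [column, dif_pos (Finset.singleton_subset_iff.2 s.2)]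
  congr 1
  funext t
  obtain ⟨t, ht⟩ := t
  obtain rfl := Finset.mem_singleton.1 ht
  rfl

theorem column_mem {H : EnergyHypergraph V} {y : (s : V) → X s}
    {ζ : (d : Finset V) → PartialLabeling X d → ℝ} (hζ : ζ ∈ zetaPolytope H y)
    (c : H.edges) (x : PartialLabeling X c.1) : column ζ x ∈ saPolytope c.1 :=
  hζ.2.2.2 c.1 c.2 x

variable [∀ s, DecidableEq (X s)]

/-- `sum_powerset_prod_sub` trades the signed expansion for the weights; each remaining product is
the indicator that the mixed labeling equals `x`. -/
theorem linearization_entry (y : (s : V) → X s)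
    (ζ : (d : Finset V) → PartialLabeling X d → ℝ) {c : Finset V} (x x' : PartialLabeling X c) :
    ∑ d ∈ c.powerset, (∏ s : c, if s.1 ∈ d
        then (if x' s = x s then (1 : ℝ) else 0) - (if y s.1 = x s then 1 else 0)
        else (if y s.1 = x s then 1 else 0)) * column ζ x' d
      = ∑ e ∈ c.powerset, (if mix y e x' = x then 1 else 0) * weight (column ζ x') c e := by
  have h := sum_powerset_prod_sub c
    (fun t => if h : t ∈ c then (if x' ⟨t, h⟩ = x ⟨t, h⟩ then (1 : ℝ) else 0) else 0)
    (fun t => if h : t ∈ c then (if y t = x ⟨t, h⟩ then (1 : ℝ) else 0) else 0) (column ζ x')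
  simp only [← Finset.prod_coe_sort c] at h
  simp only [Finset.coe_mem, dite_true] at h
  rw [h]
  refine Finset.sum_congr rfl fun e _ => ?_
  congr 1
  have h1 : ∀ s : c, (if s.1 ∈ e then (if x' s = x s then (1 : ℝ) else 0)
      else (if y s.1 = x s then 1 else 0)) = if mix y e x' s = x s then 1 else 0 := by
    intro s
    unfold mix
    split_ifs <;> rfl
  rw [Finset.prod_congr rfl fun s _ => h1 s, Finset.prod_ite_zero]
  simp [funext_iff]

variable [∀ s, Fintype (X s)]

/-- The column of `P_ζ` at `x` is a mixture of the labelings `mix y e x`. -/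
theorem vecMul_linearization (y : (s : V) → X s)
    (ζ : (d : Finset V) → PartialLabeling X d → ℝ) (F : Idx H X → ℝ) (c : H.edges)
    (x : PartialLabeling X c.1) :
    (F ᵥ* linearization H y ζ) ⟨c, x⟩
      = ∑ e ∈ c.1.powerset, weight (column ζ x) c.1 e * F ⟨c, mix y e x⟩ := by
  rw [linearization, vecMul_blockDiagonal'_apply]
  simp only [Matrix.of_apply, linearization_entry, Finset.mul_sum]
  rw [Finset.sum_comm]
  refine Finset.sum_congr rfl fun e _ => ?_
  rw [Finset.sum_eq_single_of_mem (mix y e x) (Finset.mem_univ _)]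
  · rw [if_pos rfl]; ring
  · intro x' _ hne
    rw [if_neg hne.symm]; ring

theorem vecMul_linExt (p : (s : V) → X s → X s) (F : Idx H X → ℝ) (c : H.edges)
    (x : PartialLabeling X c.1) :
    (F ᵥ* linExt H p) ⟨c, x⟩ = F ⟨c, fun s => p s.1 (x s)⟩ := by
  rw [linExt, vecMul_blockDiagonal'_apply]
  simp only [Matrix.of_apply]
  rw [Finset.sum_eq_single_of_mem (fun s => p s.1 (x s)) (Finset.mem_univ _)]
  · simp
  · intro x' _ hne
    obtain ⟨s, hs⟩ := Function.ne_iff.1 hne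
    rw [Finset.prod_eq_zero (Finset.mem_univ s), mul_zero]
    rw [if_neg fun h => hs h.symm]

/-- On row vectors both kinds of matrices act by explicit formulas, so matrix identities are checked
there. -/
theorem eq_of_forall_vecMul_eq {n : Type*} [Fintype n] {P Q : Matrix n n ℝ}
    (h : ∀ F : n → ℝ, F ᵥ* P = F ᵥ* Q) : P = Q := by
  classical
  ext i j
  have := congrFun (h (Pi.single i 1)) j
  simpa using this

variable {H} {y : (s : V) → X s} {ζ : (d : Finset V) → PartialLabeling X d → ℝ}

theorem vecMul_linearization_nonneg (hζ : ζ ∈ zetaPolytope H y) {F : Idx H X → ℝ}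
    (hF : ∀ i, 0 ≤ F i) (i : Idx H X) : 0 ≤ (F ᵥ* linearization H y ζ) i := by
  obtain ⟨c, x⟩ := i
  rw [vecMul_linearization]
  exact Finset.sum_nonneg fun e he => mul_nonneg (weight_nonneg (column_mem hζ c x) he) (hF _)

/-- A convex combination of values that all equal `r` on the support of the weights is `r`. -/
theorem vecMul_linearization_eq (hζ : ζ ∈ zetaPolytope H y) {F : Idx H X → ℝ} {c : H.edges}
    {x : PartialLabeling X c.1} {r : ℝ}
    (h : ∀ e ∈ c.1.powerset, weight (column ζ x) c.1 e ≠ 0 → F ⟨c, mix y e x⟩ = r) :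
    (F ᵥ* linearization H y ζ) ⟨c, x⟩ = r := by
  rw [vecMul_linearization, ← one_mul r, ← sum_weight (column_mem hζ c x), Finset.sum_mul]
  refine Finset.sum_congr rfl fun e he => ?_
  by_cases h0 : weight (column ζ x) c.1 e = 0
  · rw [h0, zero_mul, zero_mul]
  · rw [h e he h0]

theorem linearization_mulVec_nonneg (hζ : ζ ∈ zetaPolytope H y) {μ : Idx H X → ℝ}
    (hμ : ∀ i, 0 ≤ μ i) (i : Idx H X) : 0 ≤ (linearization H y ζ *ᵥ μ) i := by
  rw [← single_one_dotProduct i (linearization H y ζ *ᵥ μ), Matrix.dotProduct_mulVec]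
  refine dotProduct_nonneg_of_nonneg (vecMul_linearization_nonneg hζ fun j => ?_) hμ
  rw [Pi.single_apply]
  split_ifs <;> norm_num

theorem linearization_mulVec_emptyIdx (hζ : ζ ∈ zetaPolytope H y) (μ : Idx H X → ℝ) :
    (linearization H y ζ *ᵥ μ) (emptyIdx H) = μ (emptyIdx H) := by
  rw [← single_one_dotProduct (emptyIdx H) (linearization H y ζ *ᵥ μ), Matrix.dotProduct_mulVec,
    ← single_one_dotProduct (emptyIdx H) μ]
  congr 1
  funext ⟨c, x⟩
  refine vecMul_linearization_eq hζ fun e _ _ => ?_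
  -- Whether an index is the constant one depends only on its block, and mixing stays inside the
  -- block.
  have key : ∀ x' : PartialLabeling X c.1, (⟨c, x'⟩ : Idx H X) = emptyIdx H ↔ c.1 = ∅ := by
    intro x'
    constructor
    · intro h
      exact congrArg (fun i : Idx H X => i.1.1) h
    · intro h
      obtain ⟨c, hc⟩ := c
      subst h
      refine congrArg (Sigma.mk _) ?_
      funext s
      exact absurd s.2 (Finset.notMem_empty s.1)
  simp only [Pi.single_apply, key]

end Action

/-! ### The polytope `Λ` and duality certificates -/

section Relaxation

variable {V : Type*} [DecidableEq V] {H : EnergyHypergraph V} {X : V → Type*}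
  [∀ s, Fintype (X s)] {m : ℕ} {A : Matrix (Fin m) (Idx H X) ℝ}

theorem isClosed_relaxation : IsClosed (relaxation H A) := by
  have h1 : IsClosed {μ : Idx H X → ℝ | ∀ j, 0 ≤ (A *ᵥ μ) j} := by
    simp only [Set.ofPred_forall]
    refine isClosed_iInter fun j => isClosed_le continuous_const ?_
    exact (continuous_apply j).comp (Continuous.matrix_mulVec continuous_const continuous_id)
  have h2 : IsClosed {μ : Idx H X → ℝ | μ (emptyIdx H) = 1} :=
    isClosed_eq (continuous_apply _) continuous_const
  have h3 : IsClosed {μ : Idx H X → ℝ | ∀ i, 0 ≤ μ i} := by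
    simp only [Set.ofPred_forall]
    exact isClosed_iInter fun i => isClosed_le continuous_const (continuous_apply i)
  exact h1.inter (h2.inter h3)

theorem isCompact_relaxation (hb : Bornology.IsBounded (relaxation H A)) :
    IsCompact (relaxation H A) :=
  Metric.isCompact_of_isClosed_isBounded isClosed_relaxation hb

/-- A nonzero element of the cone over `Λ` is a positive multiple of an element of `Λ`. -/
theorem eq_zero_or_exists_smul_mem (hb : Bornology.IsBounded (relaxation H A))
    (hne : (relaxation H A).Nonempty) {x : Idx H X → ℝ} (hA : ∀ j, 0 ≤ (A *ᵥ x) j)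
    (hx : ∀ i, 0 ≤ x i) : x = 0 ∨ ∃ t : ℝ, 0 < t ∧ ∃ μ ∈ relaxation H A, x = t • μ := by
  rcases (hx (emptyIdx H)).eq_or_lt with h0 | h0
  · left
    obtain ⟨μ, hμ⟩ := hne
    obtain ⟨C, hC⟩ := hb.exists_norm_le
    funext i
    by_contra hi
    have hpos : 0 < x i := lt_of_le_of_ne (hx i) (Ne.symm hi)
    have hC0 : 0 ≤ C := (norm_nonneg _).trans (hC μ hμ)
    -- Since the constant component of `x` is zero, `x` is a recession direction of `Λ`; this step
    -- length pushes coordinate `i` beyond the norm bound `C`.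
    set t := (C + 1) / x i with ht
    have ht0 : 0 ≤ t := div_nonneg (by linarith) hpos.le
    have hmem : μ + t • x ∈ relaxation H A := by
      refine ⟨fun j => ?_, ?_, fun k => ?_⟩
      · rw [Matrix.mulVec_add, Matrix.mulVec_smul]
        exact add_nonneg (hμ.1 j) (mul_nonneg ht0 (hA j))
      · simp [hμ.2.1, ← h0]
      · exact add_nonneg (hμ.2.2 k) (mul_nonneg ht0 (hx k))
    have h1 := (le_abs_self _).trans ((norm_le_pi_norm _ i).trans (hC _ hmem))
    have h2 : t * x i = C + 1 := div_mul_cancel₀ _ hpos.ne'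
    have h3 := hμ.2.2 i
    simp only [Pi.add_apply, Pi.smul_apply, smul_eq_mul] at h1
    linarith
  · right
    refine ⟨x (emptyIdx H), h0, (x (emptyIdx H))⁻¹ • x, ⟨fun j => ?_, ?_, fun k => ?_⟩, ?_⟩
    · rw [Matrix.mulVec_smul]
      exact mul_nonneg (inv_nonneg.2 h0.le) (hA j)
    · simp [h0.ne']
    · exact mul_nonneg (inv_nonneg.2 h0.le) (hx k)
    · rw [smul_smul, mul_inv_cancel₀ h0.ne', one_smul]

theorem dotProduct_nonneg_of_certificate {v : Idx H X → ℝ} {φ : Fin m → ℝ} (hφ : ∀ j, 0 ≤ φ j)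
    (hv : ∀ i, 0 ≤ (v - Aᵀ *ᵥ φ) i) {μ : Idx H X → ℝ} (hμ : μ ∈ relaxation H A) :
    0 ≤ v ⬝ᵥ μ := by
  have h1 : 0 ≤ (v - Aᵀ *ᵥ φ) ⬝ᵥ μ := dotProduct_nonneg_of_nonneg hv hμ.2.2
  have h2 : 0 ≤ φ ⬝ᵥ A *ᵥ μ := dotProduct_nonneg_of_nonneg hφ hμ.1
  rw [sub_dotProduct, Matrix.mulVec_transpose, ← Matrix.dotProduct_mulVec] at h1
  linarith

/-- Boundedness and nonemptiness extend the inequality from `Λ` to the homogeneous cone, where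
Farkas applies. This is the converse of `dotProduct_nonneg_of_certificate`. -/
theorem exists_certificate (hb : Bornology.IsBounded (relaxation H A))
    (hne : (relaxation H A).Nonempty) {v : Idx H X → ℝ}
    (hv : ∀ μ ∈ relaxation H A, 0 ≤ v ⬝ᵥ μ) :
    ∃ φ : Fin m → ℝ, (∀ j, 0 ≤ φ j) ∧ ∀ i, 0 ≤ (v - Aᵀ *ᵥ φ) i := by
  refine farkas_matrix A v fun x hA hx => ?_
  rcases eq_zero_or_exists_smul_mem hb hne hA hx with rfl | ⟨t, ht, μ, hμ, rfl⟩
  · simp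
  · rw [dotProduct_smul]
    exact mul_nonneg ht.le (hv μ hμ)

/-- If `⟨v, μ⟩ ≤ 0` implies `⟨w, μ⟩ ≤ 0` on `Λ`, then `w` is dominated by a multiple of `v`
on `Λ`. -/
theorem exists_dominating_multiple (hb : Bornology.IsBounded (relaxation H A))
    (hne : (relaxation H A).Nonempty) {v w : Idx H X → ℝ}
    (h : ∀ μ ∈ relaxation H A, v ⬝ᵥ μ ≤ 0 → w ⬝ᵥ μ ≤ 0) :
    ∃ C : ℝ, 0 ≤ C ∧ ∀ μ ∈ relaxation H A, w ⬝ᵥ μ ≤ C * (v ⬝ᵥ μ) := by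
  -- The premise `⟨v, μ⟩ ≤ 0` is adjoined to `A` as an extra row; its multiplier becomes the
  -- constant `C`.
  obtain ⟨φ, hφ, hw⟩ := farkas_matrix (Matrix.of (Sum.elim A fun _ : Unit => -v)) (-w) (by
    intro x hA hx
    have hA1 : ∀ j, 0 ≤ (A *ᵥ x) j := fun j => hA (Sum.inl j)
    have hA2 : 0 ≤ (-v) ⬝ᵥ x := hA (Sum.inr ())
    rcases eq_zero_or_exists_smul_mem hb hne hA1 hx with rfl | ⟨t, ht, μ, hμ, rfl⟩
    · simp
    · rw [dotProduct_smul] at hA2 ⊢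
      rw [neg_dotProduct] at hA2 ⊢
      refine mul_nonneg ht.le (neg_nonneg.2 (h μ hμ ?_))
      exact neg_nonneg.1 (nonneg_of_mul_nonneg_right hA2 ht))
  refine ⟨φ (Sum.inr ()), hφ _, fun μ hμ => ?_⟩
  have h1 : 0 ≤ (-w - (Matrix.of (Sum.elim A fun _ : Unit => -v))ᵀ *ᵥ φ) ⬝ᵥ μ :=
    dotProduct_nonneg_of_nonneg hw hμ.2.2
  rw [sub_dotProduct, Matrix.mulVec_transpose, ← Matrix.dotProduct_mulVec, neg_dotProduct] at h1
  have h2 : φ ⬝ᵥ (Matrix.of (Sum.elim A fun _ : Unit => -v)) *ᵥ μ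
      = ∑ j, φ (Sum.inl j) * (A *ᵥ μ) j + φ (Sum.inr ()) * ((-v) ⬝ᵥ μ) := by
    rw [dotProduct, Fintype.sum_sum_type]
    simp only [Finset.univ_unique, Finset.sum_singleton]
    rfl
  rw [h2, neg_dotProduct] at h1
  have h3 : 0 ≤ ∑ j, φ (Sum.inl j) * (A *ᵥ μ) j :=
    Finset.sum_nonneg fun j _ => mul_nonneg (hφ _) (hμ.1 j)
  linarith

variable [∀ s, DecidableEq (X s)] {y : (s : V) → X s}
  {ζ : (d : Finset V) → PartialLabeling X d → ℝ} {f : Idx H X → ℝ}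

theorem relaxation_nonempty [∀ s, Nonempty (X s)] (hm : marginalPolytope H ⊆ relaxation H A) :
    (relaxation H A).Nonempty :=
  ⟨_, hm (subset_convexHull ℝ _ ⟨fun s => Classical.arbitrary (X s), rfl⟩)⟩

theorem L1Feasible.improves {φ : Fin m → ℝ} {Φ : Matrix (Fin m) (Fin m) ℝ}
    (h : L1Feasible H A f y ζ φ Φ) {μ : Idx H X → ℝ} (hμ : μ ∈ relaxation H A) :
    f ⬝ᵥ linearization H y ζ *ᵥ μ ≤ f ⬝ᵥ μ := by
  have := dotProduct_nonneg_of_certificate h.multiplier_nonneg h.improving hμ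
  rw [sub_dotProduct, Matrix.mulVec_transpose, ← Matrix.dotProduct_mulVec] at this
  linarith

theorem L1Feasible.linearization_mem {φ : Fin m → ℝ} {Φ : Matrix (Fin m) (Fin m) ℝ}
    (h : L1Feasible H A f y ζ φ Φ) {μ : Idx H X → ℝ} (hμ : μ ∈ relaxation H A) :
    linearization H y ζ *ᵥ μ ∈ relaxation H A := by
  refine ⟨fun j => ?_, ?_, linearization_mulVec_nonneg h.mem_zeta hμ.2.2⟩
  · have h1 : 0 ≤ ((A * linearization H y ζ - Φᵀ * A) *ᵥ μ) j :=
      dotProduct_nonneg_of_nonneg (h.closed j) hμ.2.2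
    have h2 : 0 ≤ (Φᵀ *ᵥ (A *ᵥ μ)) j :=
      dotProduct_nonneg_of_nonneg (fun k => h.closed_multiplier_nonneg k j) hμ.1
    rw [Matrix.sub_mulVec, ← Matrix.mulVec_mulVec, ← Matrix.mulVec_mulVec, Pi.sub_apply] at h1
    linarith
  · rw [linearization_mulVec_emptyIdx h.mem_zeta, hμ.2.1]

/-- `φ` certifies the improvement, and `Φ` collects one certificate for each row of `A * P_ζ`. -/
theorem exists_l1Feasible (hb : Bornology.IsBounded (relaxation H A))
    (hne : (relaxation H A).Nonempty) (hζ : ζ ∈ zetaPolytope H y)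
    (hall : ∀ s i j, i ≠ y s → j ≠ y s → ζ {s} (single s i) = ζ {s} (single s j))
    (hmem : ∀ μ ∈ relaxation H A, linearization H y ζ *ᵥ μ ∈ relaxation H A)
    (himp : ∀ μ ∈ relaxation H A, f ⬝ᵥ linearization H y ζ *ᵥ μ ≤ f ⬝ᵥ μ) :
    ∃ φ Φ, L1Feasible H A f y ζ φ Φ := by
  obtain ⟨φ, hφ, h1⟩ := exists_certificate hb hne
    (v := f - (linearization H y ζ)ᵀ *ᵥ f) (fun μ hμ => by
      rw [sub_dotProduct, Matrix.mulVec_transpose, ← Matrix.dotProduct_mulVec]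
      have := himp μ hμ
      linarith)
  have h2 : ∀ j, ∃ ψ : Fin m → ℝ, (∀ k, 0 ≤ ψ k) ∧
      ∀ i, 0 ≤ ((A * linearization H y ζ) j - Aᵀ *ᵥ ψ) i := fun j =>
    exists_certificate hb hne fun μ hμ => by
      have := (hmem μ hμ).1 j
      rw [Matrix.mulVec_mulVec] at this
      exact this
  choose Ψ hΨ h3 using h2
  refine ⟨φ, Matrix.of fun k j => Ψ j k, h1, hφ, fun j i => ?_, fun j k => hΨ k j, hζ, hall⟩
  have := h3 j i
  rw [Matrix.mulVec_transpose] at this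
  exact this

end Relaxation

/-! ### Rounding a feasible `ζ`, and the discrepancy from `y` -/

section Rounding

variable {V : Type*} [DecidableEq V] {H : EnergyHypergraph V} {X : V → Type*}
  {y : (s : V) → X s} {ζ : (d : Finset V) → PartialLabeling X d → ℝ} {𝒜 : Finset V}

/-- The nodes at which `ζ` moves some label with positive probability. -/
noncomputable def moved {V : Type*} [Fintype V] {X : V → Type*} (y : (s : V) → X s)
    (ζ : (d : Finset V) → PartialLabeling X d → ℝ) : Finset V :=
  open Classical in Finset.univ.filter fun s => ∃ i, i ≠ y s ∧ ζ {s} (single s i) ≠ 1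

theorem column_eq_one_of_notMem_moved [Fintype V] {c : Finset V} {x : PartialLabeling X c} {s : c}
    (hs : s.1 ∉ moved y ζ) (hx : x s ≠ y s.1) : column ζ x {s.1} = 1 := by
  rw [column_singleton]
  by_contra h
  exact hs (by simpa [moved] using ⟨x s, hx, h⟩)

/-- This is where the all-to-one constraint enters: if one label of `s` is moved with positive
probability, so is every label other than `y s`. -/
theorem column_ne_one_of_mem_moved [Fintype V]
    (hall : ∀ s i j, i ≠ y s → j ≠ y s → ζ {s} (single s i) = ζ {s} (single s j))
    {c : Finset V} {x : PartialLabeling X c} {s : c}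
    (hs : s.1 ∈ moved y ζ) (hx : x s ≠ y s.1) : column ζ x {s.1} ≠ 1 := by
  rw [column_singleton]
  obtain ⟨i, hi, h⟩ : ∃ i, i ≠ y s.1 ∧ ζ {s.1} (single s.1 i) ≠ 1 := by simpa [moved] using hs
  rwa [hall s.1 (x s) i hx hi]

variable [∀ s, DecidableEq (X s)]

/-- The number of nodes of `𝒜` in the hyperedge at which the labeling differs from `y`. -/
def discrepancy (H : EnergyHypergraph V) (y : (s : V) → X s) (𝒜 : Finset V) : Idx H X → ℝ :=
  fun i => ∑ s : i.1.1, if s.1 ∈ 𝒜 ∧ i.2 s ≠ y s.1 then 1 else 0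

theorem discrepancy_nonneg (i : Idx H X) : 0 ≤ discrepancy H y 𝒜 i :=
  Finset.sum_nonneg fun s _ => by split_ifs <;> norm_num

theorem perturb_eq (f : Idx H X → ℝ) (ε : ℝ) :
    perturb H f y ε = f + ε • perturb H 0 y 1 := by
  funext i
  simp [perturb]

theorem overwrite_eq_self_of_discrepancy {c : H.edges} {x : PartialLabeling X c.1}
    (h : discrepancy H y 𝒜 ⟨c, x⟩ = 0) : (fun s : c.1 => overwrite y 𝒜 s.1 (x s)) = x := by
  funext s
  rw [discrepancy, Finset.sum_eq_zero_iff_of_nonneg (fun s _ => by split_ifs <;> norm_num)] at h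
  have hs := h s (Finset.mem_univ s)
  by_contra hne
  rw [overwrite] at hne
  split_ifs at hne with hA
  · rw [if_pos ⟨hA, fun h => hne h.symm⟩] at hs
    exact one_ne_zero hs
  · exact hne rfl

variable [∀ s, Fintype (X s)]

/-- A nonnegative vector without discrepancy is fixed by the map. -/
theorem linExt_overwrite_mulVec_eq_self {μ : Idx H X → ℝ} (hμ : ∀ i, 0 ≤ μ i)
    (h : discrepancy H y 𝒜 ⬝ᵥ μ ≤ 0) : linExt H (overwrite y 𝒜) *ᵥ μ = μ := by
  have h0 : ∀ i, discrepancy H y 𝒜 i * μ i = 0 := by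
    have h1 : discrepancy H y 𝒜 ⬝ᵥ μ = 0 :=
      le_antisymm h (dotProduct_nonneg_of_nonneg discrepancy_nonneg hμ)
    rw [dotProduct, Finset.sum_eq_zero_iff_of_nonneg
      fun i _ => mul_nonneg (discrepancy_nonneg i) (hμ i)] at h1
    exact fun i => h1 i (Finset.mem_univ i)
  refine dotProduct_eq _ _ fun F => ?_
  rw [dotProduct_comm, Matrix.dotProduct_mulVec, dotProduct_comm μ]
  refine Finset.sum_congr rfl fun i _ => ?_
  obtain ⟨c, x⟩ := i
  rw [vecMul_linExt]
  rcases mul_eq_zero.1 (h0 ⟨c, x⟩) with h | h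
  · rw [overwrite_eq_self_of_discrepancy h]
  · rw [h, mul_zero, mul_zero]

/-- Here `perturb H 0 y 1` is the vector `g`, which counts agreements with `y`; overwriting gains
one agreement at each node of `𝒜` that differed from `y`. -/
theorem vecMul_linExt_overwrite_perturb :
    perturb H 0 y 1 ᵥ* linExt H (overwrite y 𝒜) = perturb H 0 y 1 + discrepancy H y 𝒜 := by
  funext ⟨c, x⟩
  rw [vecMul_linExt, Pi.add_apply]
  simp only [perturb, discrepancy, Pi.zero_apply, zero_add, one_mul]
  rw [← Finset.sum_add_distrib]
  refine Finset.sum_congr rfl fun s _ => ?_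
  unfold overwrite
  by_cases hA : s.1 ∈ 𝒜 <;> by_cases hx : x s = y s.1 <;> simp [hA, hx]

theorem perturb_dotProduct_linExt_overwrite (f : Idx H X → ℝ) (ε : ℝ) (μ : Idx H X → ℝ) :
    perturb H f y ε ⬝ᵥ linExt H (overwrite y 𝒜) *ᵥ μ - perturb H f y ε ⬝ᵥ μ
      = f ⬝ᵥ linExt H (overwrite y 𝒜) *ᵥ μ - f ⬝ᵥ μ + ε * (discrepancy H y 𝒜 ⬝ᵥ μ) := by
  rw [perturb_eq]
  simp only [add_dotProduct, smul_dotProduct, smul_eq_mul]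
  rw [Matrix.dotProduct_mulVec (perturb H 0 y 1), vecMul_linExt_overwrite_perturb, add_dotProduct]
  ring

theorem discrepancy_dotProduct_eq_zero {μ : Idx H X → ℝ}
    (h : linExt H (overwrite y 𝒜) *ᵥ μ = μ) : discrepancy H y 𝒜 ⬝ᵥ μ = 0 := by
  have := perturb_dotProduct_linExt_overwrite (H := H) (y := y) (𝒜 := 𝒜) 0 1 μ
  rw [h] at this
  simpa using this.symm

variable [Fintype V]

/-- `P_ζ` changes labels only at moved nodes, up to weight zero, and the overwriting forgets the
labels there. -/
theorem linExt_overwrite_mul_linearization (hζ : ζ ∈ zetaPolytope H y) :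
    linExt H (overwrite y (moved y ζ)) * linearization H y ζ
      = linExt H (overwrite y (moved y ζ)) := by
  refine eq_of_forall_vecMul_eq fun F => ?_
  rw [← Matrix.vecMul_vecMul]
  funext ⟨c, x⟩
  refine vecMul_linearization_eq hζ fun e he h0 => ?_
  rw [vecMul_linExt, vecMul_linExt]
  congr 2
  funext s
  unfold overwrite mix
  by_cases hA : s.1 ∈ moved y ζ
  · simp [hA]
  · simp only [hA, if_false]
    by_cases hse : s.1 ∈ e
    · rw [if_pos hse]
    · rw [if_neg hse]
      by_contra hne
      exact h0 (weight_eq_zero_of_eq_one (column_mem hζ c x) s.2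
        (column_eq_one_of_notMem_moved hA (Ne.symm hne)) he hse)

/-- `P_ζ` decreases the discrepancy strictly wherever it does not vanish. -/
theorem discrepancy_sub_vecMul (hζ : ζ ∈ zetaPolytope H y)
    (hall : ∀ s i j, i ≠ y s → j ≠ y s → ζ {s} (single s i) = ζ {s} (single s j))
    (i : Idx H X) :
    0 ≤ (discrepancy H y (moved y ζ) - discrepancy H y (moved y ζ) ᵥ* linearization H y ζ) i ∧
      ((discrepancy H y (moved y ζ) - discrepancy H y (moved y ζ) ᵥ* linearization H y ζ) i = 0 →
        discrepancy H y (moved y ζ) i = 0) := by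
  obtain ⟨c, x⟩ := i
  have hz := column_mem hζ c x
  -- The decrease is the expected number of moved nodes that differ from `y` and are dropped. If it
  -- is zero, any such node would be kept almost surely, contradicting that it is moved.
  have key : (discrepancy H y (moved y ζ) - discrepancy H y (moved y ζ) ᵥ* linearization H y ζ)
      ⟨c, x⟩ = ∑ e ∈ c.1.powerset, weight (column ζ x) c.1 e *
        ∑ s : c.1, if (s.1 ∈ moved y ζ ∧ x s ≠ y s.1) ∧ s.1 ∉ e then 1 else 0 := by
    have h1 : discrepancy H y (moved y ζ) ⟨c, x⟩ = ∑ e ∈ c.1.powerset,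
        weight (column ζ x) c.1 e * discrepancy H y (moved y ζ) ⟨c, x⟩ := by
      rw [← Finset.sum_mul, sum_weight hz, one_mul]
    rw [Pi.sub_apply, vecMul_linearization, h1, ← Finset.sum_sub_distrib]
    refine Finset.sum_congr rfl fun e _ => ?_
    rw [← mul_sub, discrepancy, discrepancy, ← Finset.sum_sub_distrib]
    congr 1
    refine Finset.sum_congr rfl fun s _ => ?_
    unfold mix
    by_cases h1 : s.1 ∈ moved y ζ <;> by_cases h2 : x s = y s.1 <;> by_cases h3 : s.1 ∈ e <;>
      simp [h1, h2, h3]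
  have hnn : ∀ e ∈ c.1.powerset, 0 ≤ weight (column ζ x) c.1 e *
      ∑ s : c.1, if (s.1 ∈ moved y ζ ∧ x s ≠ y s.1) ∧ s.1 ∉ e then (1 : ℝ) else 0 := fun e he =>
    mul_nonneg (weight_nonneg hz he) (Finset.sum_nonneg fun s _ => by split_ifs <;> norm_num)
  rw [key]
  refine ⟨Finset.sum_nonneg hnn, fun h0 => ?_⟩
  rw [Finset.sum_eq_zero_iff_of_nonneg hnn] at h0
  refine Finset.sum_eq_zero fun s _ => if_neg ?_
  rintro ⟨hA, hx⟩
  refine column_ne_one_of_mem_moved hall hA hx (eq_one_of_weight_eq_zero hz s.2 fun e he hse => ?_)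
  refine (mul_eq_zero.1 (h0 e he)).resolve_right (ne_of_gt ?_)
  refine Finset.sum_pos' (fun t _ => by split_ifs <;> norm_num) ⟨s, Finset.mem_univ s, ?_⟩
  rw [if_pos ⟨⟨hA, hx⟩, hse⟩]
  exact one_pos

/-- Rounding a feasible `ζ` by moving all labels that are moved with positive probability gives
a map that preserves `Λ` and does not increase the costs. -/
theorem L1Feasible.overwrite_moved {m : ℕ} {A : Matrix (Fin m) (Idx H X) ℝ} {f : Idx H X → ℝ}
    {φ : Fin m → ℝ} {Φ : Matrix (Fin m) (Fin m) ℝ}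
    (hb : Bornology.IsBounded (relaxation H A)) (h : L1Feasible H A f y ζ φ Φ)
    {μ : Idx H X → ℝ} (hμ : μ ∈ relaxation H A) :
    linExt H (overwrite y (moved y ζ)) *ᵥ μ ∈ relaxation H A ∧
      f ⬝ᵥ linExt H (overwrite y (moved y ζ)) *ᵥ μ ≤ f ⬝ᵥ μ := by
  set Q := linExt H (overwrite y (moved y ζ)) with hQ
  set P := linearization H y ζ with hP
  set D := discrepancy H y (moved y ζ)
  -- `P` maps this compact set to itself, so a minimizer of the discrepancy on it cannot be improved
  -- by `P`; this replaces a limit of powers of `P`.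
  let S : Set (Idx H X → ℝ) := relaxation H A ∩ {ν | f ⬝ᵥ ν ≤ f ⬝ᵥ μ ∧ Q *ᵥ ν = Q *ᵥ μ}
  have hS : IsCompact S := by
    refine (isCompact_relaxation hb).inter_right (IsClosed.inter ?_ ?_)
    · exact isClosed_le (continuous_const.dotProduct continuous_id) continuous_const
    · exact isClosed_eq (Continuous.matrix_mulVec continuous_const continuous_id) continuous_const
  obtain ⟨ν, ⟨hν, hfν, hQν⟩, hmin⟩ := hS.exists_isMinOn ⟨μ, hμ, le_rfl, rfl⟩
    (f := fun ν => D ⬝ᵥ ν) (continuous_const.dotProduct continuous_id).continuousOn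
  have hPν : P *ᵥ ν ∈ S := by
    refine ⟨h.linearization_mem hν, (h.improves hν).trans hfν, ?_⟩
    rw [Matrix.mulVec_mulVec, hQ, hP, linExt_overwrite_mul_linearization h.mem_zeta, ← hQ, hQν]
  have hle : D ⬝ᵥ ν ≤ D ⬝ᵥ P *ᵥ ν := hmin hPν
  have hfix : Q *ᵥ ν = ν := by
    refine linExt_overwrite_mulVec_eq_self hν.2.2 (le_of_eq ?_)
    have hnn : ∀ i ∈ Finset.univ, 0 ≤ (D - D ᵥ* P) i * ν i := fun i _ =>
      mul_nonneg (discrepancy_sub_vecMul h.mem_zeta h.all_to_one i).1 (hν.2.2 i)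
    have h0 : ∑ i, (D - D ᵥ* P) i * ν i = 0 := by
      refine le_antisymm ?_ (Finset.sum_nonneg hnn)
      change (D - D ᵥ* P) ⬝ᵥ ν ≤ 0
      rw [sub_dotProduct, ← Matrix.dotProduct_mulVec]
      linarith
    rw [Finset.sum_eq_zero_iff_of_nonneg hnn] at h0
    refine Finset.sum_eq_zero fun i hi => ?_
    rcases mul_eq_zero.1 (h0 i hi) with h1 | h1
    · rw [(discrepancy_sub_vecMul h.mem_zeta h.all_to_one i).2 h1, zero_mul]
    · rw [h1, mul_zero]
  rw [← hQν, hfix]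
  exact ⟨hν, hfν⟩

end Rounding

/-! ### Invariance of local polytopes under node-wise maps -/

section LocalPolytope

variable {V : Type*} [DecidableEq V] {H : EnergyHypergraph V} {X : V → Type*}
  [∀ s, DecidableEq (X s)] [∀ s, Fintype (X s)]

theorem linExt_mulVec_apply (p : (s : V) → X s → X s) (μ : Idx H X → ℝ) (c : H.edges)
    (x : PartialLabeling X c.1) :
    (linExt H p *ᵥ μ) ⟨c, x⟩
      = ∑ x' : PartialLabeling X c.1, if (fun s => p s.1 (x' s)) = x then μ ⟨c, x'⟩ else 0 := by
  rw [← single_one_dotProduct ⟨c, x⟩ (linExt H p *ᵥ μ), Matrix.dotProduct_mulVec, dotProduct,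
    Fintype.sum_sigma, Finset.sum_eq_single_of_mem c (Finset.mem_univ c)]
  · refine Finset.sum_congr rfl fun x' _ => ?_
    rw [vecMul_linExt, Pi.single_apply]
    simp
  · intro c' _ hne
    refine Finset.sum_eq_zero fun x' _ => ?_
    rw [vecMul_linExt, Pi.single_apply, if_neg fun h => hne (congrArg Sigma.fst h), zero_mul]

/-- Every node-wise map preserves every local polytope. -/
theorem mem_preserving_localPolytope (J : H.edges → H.edges → Prop) (p : (s : V) → X s → X s) :
    p ∈ preserving H (localPolytope H J) := by
  rintro μ ⟨hJ, h0, hnn⟩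
  refine ⟨fun d c hdc h xd => ?_, ?_, fun ⟨c, x⟩ => ?_⟩
  · have h1 : ∀ x' : PartialLabeling X c.1,
        (if (fun s : d.1 => p s.1 (Finset.restrict₂ h x' s)) = xd then μ ⟨c, x'⟩ else 0)
        = ∑ zd : PartialLabeling X d.1, if (fun s : d.1 => p s.1 (zd s)) = xd then
            (if Finset.restrict₂ h x' = zd then μ ⟨c, x'⟩ else 0) else 0 := by
      intro x'
      rw [Finset.sum_eq_single_of_mem (Finset.restrict₂ h x') (Finset.mem_univ _)]
      · rw [if_pos (Eq.refl (Finset.restrict₂ h x'))]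
      · intro zd _ hne
        rw [if_neg hne.symm, ite_self]
    -- A node-wise map commutes with restriction, so the sum over `x'` can be grouped by its
    -- restriction to `d`, where the constraint for `μ` applies.
    calc ∑ xc : PartialLabeling X c.1,
          (if Finset.restrict₂ h xc = xd then (linExt H p *ᵥ μ) ⟨c, xc⟩ else 0)
        = ∑ xc : PartialLabeling X c.1, ∑ x' : PartialLabeling X c.1,
            if (fun s => p s.1 (x' s)) = xc then
              (if Finset.restrict₂ h xc = xd then μ ⟨c, x'⟩ else 0) else 0 := by
          refine Finset.sum_congr rfl fun xc _ => ?_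
          rw [linExt_mulVec_apply]
          by_cases hx : Finset.restrict₂ h xc = xd
          · simp only [hx, if_true]
          · simp only [hx, if_false, ite_self, Finset.sum_const_zero]
      _ = ∑ x' : PartialLabeling X c.1,
            if (fun s : d.1 => p s.1 (Finset.restrict₂ h x' s)) = xd then μ ⟨c, x'⟩ else 0 := by
          rw [Finset.sum_comm]
          refine Finset.sum_congr rfl fun x' _ => ?_
          rw [Finset.sum_ite_eq, if_pos (Finset.mem_univ _)]
          rfl
      _ = ∑ zd : PartialLabeling X d.1, if (fun s : d.1 => p s.1 (zd s)) = xd then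
            ∑ x' : PartialLabeling X c.1, (if Finset.restrict₂ h x' = zd then μ ⟨c, x'⟩ else 0)
            else 0 := by
          rw [Finset.sum_congr rfl fun x' _ => h1 x', Finset.sum_comm]
          refine Finset.sum_congr rfl fun zd _ => ?_
          split_ifs
          exacts [rfl, Finset.sum_const_zero]
      _ = (linExt H p *ᵥ μ) ⟨d, xd⟩ := by
          rw [linExt_mulVec_apply]
          refine Finset.sum_congr rfl fun zd _ => ?_
          rw [hJ d c hdc h zd]
  · rw [← h0, emptyIdx, linExt_mulVec_apply]
    have huniq : ∀ x x' : PartialLabeling X (∅ : Finset V), x = x' := fun x x' =>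
      funext fun s => absurd s.2 (Finset.notMem_empty s.1)
    rw [Finset.sum_eq_single_of_mem (fun s => absurd s.2 (Finset.notMem_empty s.1))
      (Finset.mem_univ _) fun x' _ hne => absurd (huniq _ _) hne, if_pos (huniq _ _)]
  · rw [linExt_mulVec_apply]
    exact Finset.sum_nonneg fun x' _ => by split_ifs; exacts [hnn _, le_rfl]

end LocalPolytope

/-! ### Integral `ζ` and the maps they represent -/

section IntegralZeta

variable {V : Type*} [DecidableEq V] {H : EnergyHypergraph V} {X : V → Type*}
  {y : (s : V) → X s} {ζ : (d : Finset V) → PartialLabeling X d → ℝ} {𝒜 : Finset V}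

/-- The integral vector `ζ` that represents the map `x ↦ x[𝒜 ← y]`. -/
noncomputable def intZeta (H : EnergyHypergraph V) (y : (s : V) → X s) (𝒜 : Finset V) :
    (d : Finset V) → PartialLabeling X d → ℝ :=
  open Classical in fun d x =>
    if (∃ c ∈ H.edges, d ⊆ c) ∧ ∀ s : d, s.1 ∉ 𝒜 ∧ x s ≠ y s.1 then 1 else 0

/-- The nodes at which the map `x ↦ x[𝒜 ← y]` keeps a label different from `y`. -/
noncomputable def kept (y : (s : V) → X s) (𝒜 : Finset V) {c : Finset V}
    (x : PartialLabeling X c) : Finset V :=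
  open Classical in c.filter fun s => ∃ h : s ∈ c, s ∉ 𝒜 ∧ x ⟨s, h⟩ ≠ y s

theorem kept_subset {c : Finset V} (x : PartialLabeling X c) : kept y 𝒜 x ⊆ c := by
  classical exact Finset.filter_subset _ _

theorem mem_kept {c : Finset V} {x : PartialLabeling X c} (s : c) :
    s.1 ∈ kept y 𝒜 x ↔ s.1 ∉ 𝒜 ∧ x s ≠ y s.1 := by
  simp [kept]

theorem column_intZeta {c d : Finset V} (hc : c ∈ H.edges) (x : PartialLabeling X c)
    (hd : d ⊆ c) : column (intZeta H y 𝒜) x d = if d ⊆ kept y 𝒜 x then 1 else 0 := by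
  classical
  rw [column, dif_pos hd, intZeta]
  refine if_congr ?_ rfl rfl
  rw [and_iff_right ⟨c, hc, hd⟩]
  constructor
  · intro h s hs
    exact (mem_kept ⟨s, hd hs⟩).2 (h ⟨s, hs⟩)
  · intro h s
    exact (mem_kept ⟨s.1, hd s.2⟩).1 (h s.2)

theorem intZeta_single (s : V) (i : X s) [Decidable (s ∉ 𝒜 ∧ i ≠ y s)] :
    intZeta H y 𝒜 {s} (single s i) = if s ∉ 𝒜 ∧ i ≠ y s then 1 else 0 := by
  classical
  rw [intZeta]
  refine if_congr ?_ rfl rfl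
  rw [and_iff_right ⟨{s}, H.singleton_mem s, subset_rfl⟩]
  constructor
  · intro h
    exact h ⟨s, Finset.mem_singleton_self s⟩
  · rintro h ⟨t, ht⟩
    obtain rfl := Finset.mem_singleton.1 ht
    exact h

/-- For an integral `ζ` the random kept set is deterministic. -/
theorem weight_intZeta (c : H.edges) (x : PartialLabeling X c.1) {e : Finset V} (he : e ⊆ c.1) :
    weight (column (intZeta H y 𝒜) x) c.1 e = if e = kept y 𝒜 x then 1 else 0 :=
  weight_indicator (fun _ hd => column_intZeta c.2 x hd) (kept_subset x) he

theorem intZeta_mem_zetaPolytope : intZeta H y 𝒜 ∈ zetaPolytope H y := by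
  refine ⟨fun d x h => ?_, fun x => ?_, fun d x h => ?_, fun c hc x => ⟨?_, fun b hb => ?_⟩⟩
  · exact if_neg fun ⟨⟨c, hc, hd⟩, _⟩ => h c hc hd
  · exact if_pos ⟨⟨∅, H.empty_mem, subset_rfl⟩, fun s => absurd s.2 (Finset.notMem_empty s.1)⟩
  · obtain ⟨s, hs⟩ := h
    exact if_neg fun h' => (h'.2 s).2 hs
  · rw [column_intZeta hc x (Finset.empty_subset c), if_pos (Finset.empty_subset _)]
  · change 0 ≤ weight _ c b
    rw [weight_intZeta ⟨c, hc⟩ x hb]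
    split_ifs <;> norm_num

theorem intZeta_all_to_one (s : V) (i j : X s) (hi : i ≠ y s) (hj : j ≠ y s) :
    intZeta H y 𝒜 {s} (single s i) = intZeta H y 𝒜 {s} (single s j) := by
  classical
  rw [intZeta_single, intZeta_single]
  simp [hi, hj]

/-- The lifted variables are determined by integral unary variables. -/
theorem eq_intZeta (hζ : ζ ∈ zetaPolytope H y)
    (h : ∀ s i, ζ {s} (single s i) = intZeta H y 𝒜 {s} (single s i)) : ζ = intZeta H y 𝒜 := by
  classical
  have hint := intZeta_mem_zetaPolytope (H := H) (y := y) (𝒜 := 𝒜)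
  funext d x
  by_cases hd : ∃ c ∈ H.edges, d ⊆ c
  · obtain ⟨c, hc, hdc⟩ := hd
    -- Any extension of `x` to `c` would do: it only places `ζ d x` in a column of the Sherali-Adams
    -- polytope of `c`.
    let xc : PartialLabeling X c := fun s => if hs : s.1 ∈ d then x ⟨s.1, hs⟩ else y s.1
    have hx : Finset.restrict₂ hdc xc = x := by
      funext s
      exact dif_pos s.2
    have hcol : ∀ ζ' : (d : Finset V) → PartialLabeling X d → ℝ, ζ' d x = column ζ' xc d := by
      intro ζ'
      rw [column, dif_pos hdc, hx]
    have hsing : ∀ s ∈ c, column ζ xc {s} = column (intZeta H y 𝒜) xc {s} := by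
      intro s hs
      rw [column_singleton ζ xc ⟨s, hs⟩, column_singleton _ xc ⟨s, hs⟩]
      exact h s _
    rw [hcol ζ, hcol (intZeta H y 𝒜), column_intZeta hc xc hdc]
    have hz := column_mem hζ ⟨c, hc⟩ xc
    split_ifs with hk
    · refine saPolytope_eq_one hz hdc fun s hs => ?_
      rw [hsing s (hdc hs), column_intZeta hc xc (Finset.singleton_subset_iff.2 (hdc hs)),
        if_pos (Finset.singleton_subset_iff.2 (hk hs))]
    · obtain ⟨s, hsd, hsk⟩ := Finset.not_subset.1 hk
      refine saPolytope_eq_zero hz hdc hsd ?_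
      rw [hsing s (hdc hsd), column_intZeta hc xc (Finset.singleton_subset_iff.2 (hdc hsd)),
        if_neg fun h => hsk (Finset.singleton_subset_iff.1 h)]
  · have hd' : ∀ c ∈ H.edges, ¬ d ⊆ c := fun c hc h => hd ⟨c, hc, h⟩
    rw [hζ.1 d x hd', hint.1 d x hd']

theorem roundMap_intZeta : roundMap y (intZeta H y 𝒜) = overwrite y 𝒜 := by
  classical
  funext s i
  rw [roundMap, overwrite, intZeta_single]
  by_cases hs : s ∈ 𝒜
  · simp [hs]
  · by_cases hi : i = y s <;> simp [hs, hi]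

/-- The unary variables of a feasible `ζ` dominate those of its rounding. -/
theorem intZeta_moved_le [Fintype V] (hζ : ζ ∈ zetaPolytope H y) (s : V) (i : X s) :
    intZeta H y (moved y ζ) {s} (single s i) ≤ ζ {s} (single s i) := by
  classical
  have hcol : column ζ (single s i) {s} = ζ {s} (single s i) :=
    column_singleton ζ (single s i) ⟨s, Finset.mem_singleton_self s⟩
  rw [intZeta_single]
  split_ifs with h
  · rw [← hcol]
    exact (column_eq_one_of_notMem_moved (x := single s i)
      (s := ⟨s, Finset.mem_singleton_self s⟩) h.1 h.2).ge
  · rw [← hcol]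
    exact saPolytope_nonneg (column_mem hζ ⟨{s}, H.singleton_mem s⟩ _) subset_rfl

variable [∀ s, Fintype (X s)]

theorem l1Objective_intZeta_moved_le [Fintype V] (hζ : ζ ∈ zetaPolytope H y) :
    l1Objective (intZeta H y (moved y ζ)) ≤ l1Objective ζ :=
  Finset.sum_le_sum fun s _ => Finset.sum_le_sum fun i _ => intZeta_moved_le hζ s i

/-- Termwise domination with equal totals forces equal unary variables, and these determine the
lifted ones. -/
theorem eq_intZeta_moved [Fintype V] (hζ : ζ ∈ zetaPolytope H y)
    (h : l1Objective ζ ≤ l1Objective (intZeta H y (moved y ζ))) :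
    ζ = intZeta H y (moved y ζ) := by
  refine eq_intZeta hζ fun s i => ?_
  have h1 := (Finset.sum_eq_sum_iff_of_le fun s _ =>
    Finset.sum_le_sum fun i _ => intZeta_moved_le hζ s i).1
    (le_antisymm (l1Objective_intZeta_moved_le hζ) h) s (Finset.mem_univ s)
  exact ((Finset.sum_eq_sum_iff_of_le fun i _ => intZeta_moved_le hζ s i).1 h1 i
    (Finset.mem_univ i)).symm

variable [∀ s, DecidableEq (X s)]

/-- Each label other than `y s` is either kept or eliminated. The total depends only on `y`, so
minimizing the objective means maximizing the eliminations. -/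
theorem l1Objective_intZeta_add_eliminated [Fintype V] :
    l1Objective (intZeta H y 𝒜) + eliminated (overwrite y 𝒜)
      = ∑ s, ∑ i, if i ≠ y s then (1 : ℝ) else 0 := by
  classical
  rw [l1Objective, eliminated]
  push_cast
  rw [← Finset.sum_add_distrib]
  refine Finset.sum_congr rfl fun s _ => ?_
  rw [← Finset.sum_add_distrib]
  refine Finset.sum_congr rfl fun i _ => ?_
  rw [intZeta_single, overwrite]
  by_cases hs : s ∈ 𝒜 <;> by_cases hi : i = y s
  · simp [hs, hi]
  · simp [hs, hi, Ne.symm hi]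
  · simp [hs, hi]
  · simp [hs, hi]

theorem linearization_intZeta :
    linearization H y (intZeta H y 𝒜) = linExt H (overwrite y 𝒜) := by
  classical
  refine eq_of_forall_vecMul_eq fun F => ?_
  funext ⟨c, x⟩
  rw [vecMul_linearization, vecMul_linExt, Finset.sum_eq_single_of_mem (kept y 𝒜 x)
    (Finset.mem_powerset.2 (kept_subset x)), weight_intZeta c x (kept_subset x), if_pos rfl,
    one_mul]
  · congr 2
    funext s
    rw [mix, overwrite]
    simp only [mem_kept]
    by_cases hs : s.1 ∈ 𝒜 <;> by_cases hi : x s = y s.1 <;> simp [hs, hi]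
  · intro e he hne
    rw [weight_intZeta c x (Finset.mem_powerset.1 he), if_neg hne, zero_mul]

end IntegralZeta

/-! ### Perturbation, test labeling and integrality of the optimum -/

section MaxSI

variable {V : Type*} [DecidableEq V] {H : EnergyHypergraph V} {X : V → Type*}

theorem overwrite_mem_allToOneUnknown (y : (s : V) → X s) (𝒜 : Finset V) :
    overwrite y 𝒜 ∈ allToOneUnknown :=
  Set.mem_iUnion.2 ⟨y, 𝒜, rfl⟩

variable [∀ s, Fintype (X s)] {m : ℕ} {A : Matrix (Fin m) (Idx H X) ℝ}

theorem argminOver_nonempty (hb : Bornology.IsBounded (relaxation H A))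
    (hne : (relaxation H A).Nonempty) (f : Idx H X → ℝ) :
    (argminOver H (relaxation H A) f).Nonempty := by
  obtain ⟨μ, hμ, hmin⟩ := (isCompact_relaxation hb).exists_isMinOn hne (f := fun ν => f ⬝ᵥ ν)
    (continuous_const.dotProduct continuous_id).continuousOn
  exact ⟨μ, hμ, fun ν hν => hmin hν⟩

variable [∀ s, DecidableEq (X s)] {f : Idx H X → ℝ} {y : (s : V) → X s}
  {ζ : (d : Finset V) → PartialLabeling X d → ℝ} {𝒜 : Finset V}

/-- Strict improvement for `f` implies improvement for all small perturbations. -/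
theorem exists_perturbation_bound (hb : Bornology.IsBounded (relaxation H A))
    (hne : (relaxation H A).Nonempty) (f : Idx H X → ℝ) (y : (s : V) → X s) (𝒜 : Finset V) :
    ∃ δ : ℝ, 0 < δ ∧ ∀ ε : ℝ, 0 < ε → ε ≤ δ →
      linExt H (overwrite y 𝒜) ∈ strictImproving H (relaxation H A) f →
      ∀ μ ∈ relaxation H A,
        perturb H f y ε ⬝ᵥ linExt H (overwrite y 𝒜) *ᵥ μ ≤ perturb H f y ε ⬝ᵥ μ := by
  by_cases hs : linExt H (overwrite y 𝒜) ∈ strictImproving H (relaxation H A) f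
  swap
  · exact ⟨1, one_pos, fun _ _ _ h => absurd h hs⟩
  have hv : ∀ μ, (f - f ᵥ* linExt H (overwrite y 𝒜)) ⬝ᵥ μ
      = f ⬝ᵥ μ - f ⬝ᵥ linExt H (overwrite y 𝒜) *ᵥ μ := fun μ => by
    rw [sub_dotProduct, Matrix.dotProduct_mulVec]
  obtain ⟨C, hC, hle⟩ := exists_dominating_multiple hb hne
    (v := f - f ᵥ* linExt H (overwrite y 𝒜)) (w := discrepancy H y 𝒜) (fun μ hμ h => by
      rw [hv] at h
      refine (discrepancy_dotProduct_eq_zero ?_).le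
      by_contra hne
      have := hs μ hμ hne
      linarith)
  -- The perturbation costs `ε` times the discrepancy, at most `ε * C` times the gain in `f`; `C +
  -- 1` gives `ε * C ≤ 1` and also covers `C = 0`.
  refine ⟨1 / (C + 1), by positivity, fun ε hε hεδ _ μ hμ => ?_⟩
  have h1 := hle μ hμ
  rw [hv] at h1
  have h2 : 0 ≤ f ⬝ᵥ μ - f ⬝ᵥ linExt H (overwrite y 𝒜) *ᵥ μ := by
    by_cases h : linExt H (overwrite y 𝒜) *ᵥ μ = μ
    · rw [h, sub_self]
    · exact sub_nonneg.2 (hs μ hμ h).le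
  have h3 : ε * C ≤ 1 := by
    have := (le_div_iff₀ (by positivity)).1 hεδ
    linarith
  have h4 := mul_le_mul_of_nonneg_left h1 hε.le
  have h5 := mul_le_mul_of_nonneg_right h3 h2
  have h6 := perturb_dotProduct_linExt_overwrite (y := y) (𝒜 := 𝒜) f ε μ
  linarith

/-- Where `μ` is not fixed the discrepancy is positive, so the gain in `f` must pay for a positive
perturbation cost. -/
theorem strictImproving_of_perturb {ε : ℝ} (hε : 0 < ε)
    (h : ∀ μ ∈ relaxation H A,
      perturb H f y ε ⬝ᵥ linExt H (overwrite y 𝒜) *ᵥ μ ≤ perturb H f y ε ⬝ᵥ μ) :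
    linExt H (overwrite y 𝒜) ∈ strictImproving H (relaxation H A) f := by
  intro μ hμ hne
  have h1 : 0 < discrepancy H y 𝒜 ⬝ᵥ μ := by
    by_contra hneg
    exact hne (linExt_overwrite_mulVec_eq_self hμ.2.2 (not_lt.1 hneg))
  have h2 := mul_pos hε h1
  have h3 := h μ hμ
  have h4 := perturb_dotProduct_linExt_overwrite (y := y) (𝒜 := 𝒜) f ε μ
  linarith

/-- A strictly improving all-to-one map that preserves `Λ` has the test labeling as target. -/
theorem exists_eq_overwrite
    (hnormalized : ∀ μ ∈ relaxation H A, ∀ s, ∑ i, μ (nodeIdx H s i) = 1) {μ : Idx H X → ℝ}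
    (hμ : μ ∈ argminOver H (relaxation H A) f) (hy : IsTestLabeling H μ y)
    {q : (s : V) → X s → X s}
    (hq : q ∈ allToOneUnknown ∩ preserving H (relaxation H A))
    (hs : linExt H q ∈ strictImproving H (relaxation H A) f) : ∃ 𝒜, q = overwrite y 𝒜 := by
  obtain ⟨hq1, hq2⟩ := hq
  obtain ⟨y', 𝒜, rfl⟩ := Set.mem_iUnion.1 hq1
  change linExt H (overwrite y' 𝒜) ∈ _ at hs
  -- The image of the minimizer lies in `Λ`, so it cannot be strictly cheaper.
  have hfix : linExt H (overwrite y' 𝒜) *ᵥ μ = μ := by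
    by_contra hne
    exact absurd (hs μ hμ.1 hne) (not_lt.2 (hμ.2 _ (hq2 μ hμ.1)))
  have h0 := discrepancy_dotProduct_eq_zero hfix
  rw [dotProduct, Finset.sum_eq_zero_iff_of_nonneg
    fun i _ => mul_nonneg (discrepancy_nonneg i) (hμ.1.2.2 i)] at h0
  have hzero : ∀ s ∈ 𝒜, ∀ i, i ≠ y' s → μ (nodeIdx H s i) = 0 := by
    intro s hsA i hi
    refine (mul_eq_zero.1 (h0 (nodeIdx H s i) (Finset.mem_univ _))).resolve_left (ne_of_gt ?_)
    refine Finset.sum_pos' (fun t _ => by split_ifs <;> norm_num)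
      ⟨⟨s, Finset.mem_singleton_self s⟩, Finset.mem_univ _, ?_⟩
    rw [if_pos ⟨hsA, hi⟩]
    exact one_pos
  refine ⟨𝒜, ?_⟩
  funext s i
  rw [overwrite]
  split_ifs with hsA
  · have h1 : μ (nodeIdx H s (y' s)) = 1 := by
      rw [← hnormalized μ hμ.1 s]
      exact (Finset.sum_eq_single_of_mem _ (Finset.mem_univ _)
        fun i _ hi => hzero s hsA i hi).symm
    have h2 := hy s ⟨_, h1⟩
    by_contra hne
    rw [hzero s hsA _ (Ne.symm hne)] at h2
    exact zero_ne_one h2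
  · rfl

theorem exists_l1Feasible_intZeta (hb : Bornology.IsBounded (relaxation H A))
    (hne : (relaxation H A).Nonempty) (hp : overwrite y 𝒜 ∈ preserving H (relaxation H A))
    (himp : ∀ μ ∈ relaxation H A, f ⬝ᵥ linExt H (overwrite y 𝒜) *ᵥ μ ≤ f ⬝ᵥ μ) :
    ∃ φ Φ, L1Feasible H A f y (intZeta H y 𝒜) φ Φ := by
  refine exists_l1Feasible hb hne intZeta_mem_zetaPolytope intZeta_all_to_one ?_ ?_
  · rwa [linearization_intZeta]
  · rwa [linearization_intZeta]

variable [Fintype V]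

theorem L1Feasible.exists_intZeta_moved (hb : Bornology.IsBounded (relaxation H A))
    {φ : Fin m → ℝ} {Φ : Matrix (Fin m) (Fin m) ℝ} (hne : (relaxation H A).Nonempty)
    (h : L1Feasible H A f y ζ φ Φ) :
    ∃ φ Φ, L1Feasible H A f y (intZeta H y (moved y ζ)) φ Φ :=
  exists_l1Feasible_intZeta hb hne (fun _ hμ => (h.overwrite_moved hb hμ).1)
    fun _ hμ => (h.overwrite_moved hb hμ).2

/-- Rounding reduces the program to finitely many sets `𝒜`, and `𝒜 = ∅`, which acts as the identity
on `Λ`, is feasible. -/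
theorem exists_isL1Solution (hb : Bornology.IsBounded (relaxation H A))
    (hne : (relaxation H A).Nonempty) (f : Idx H X → ℝ) (y : (s : V) → X s) :
    ∃ ζ φ Φ, IsL1Solution H A f y ζ φ Φ := by
  have hid : ∀ μ ∈ relaxation H A, linExt H (overwrite y ∅) *ᵥ μ = μ := fun μ hμ =>
    linExt_overwrite_mulVec_eq_self hμ.2.2 (by
      have : discrepancy H y ∅ = 0 := by
        funext i
        simp [discrepancy]
      rw [this, zero_dotProduct])
  obtain ⟨𝒜, ⟨φ, Φ, h⟩, hmin⟩ := Set.exists_min_image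
    {𝒜 : Finset V | ∃ φ Φ, L1Feasible H A f y (intZeta H y 𝒜) φ Φ}
    (fun 𝒜 => l1Objective (intZeta H y 𝒜)) (Set.toFinite _)
    ⟨∅, exists_l1Feasible_intZeta hb hne (fun μ hμ => (hid μ hμ).symm ▸ hμ)
      fun μ hμ => (congrArg _ (hid μ hμ)).le⟩
  exact ⟨_, φ, Φ, h, fun ζ' φ' Φ' h' => (hmin _ (h'.exists_intZeta_moved hb hne)).trans
    (l1Objective_intZeta_moved_le h'.mem_zeta)⟩

theorem IsL1Solution.eq_intZeta (hb : Bornology.IsBounded (relaxation H A))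
    (hne : (relaxation H A).Nonempty) {φ : Fin m → ℝ} {Φ : Matrix (Fin m) (Fin m) ℝ}
    (h : IsL1Solution H A f y ζ φ Φ) : ζ = intZeta H y (moved y ζ) := by
  obtain ⟨φ', Φ', h'⟩ := h.1.exists_intZeta_moved hb hne
  exact eq_intZeta_moved h.1.mem_zeta (h.2 _ φ' Φ' h')

end MaxSI

end MaxPersistency

theorem mainTheorem3 {V : Type*} [Fintype V] [DecidableEq V] (H : EnergyHypergraph V)
    {X : V → Type*} [∀ s, Fintype (X s)] [∀ s, DecidableEq (X s)] [∀ s, Nonempty (X s)]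
    {m : ℕ} (A : Matrix (Fin m) (Idx H X) ℝ)
    (hbounded : Bornology.IsBounded (relaxation H A))
    (hmarginal : marginalPolytope H ⊆ relaxation H A)
    (hnormalized : ∀ μ ∈ relaxation H A, ∀ s, ∑ i, μ (nodeIdx H s i) = 1)
    (f : Idx H X → ℝ) :
    (argminOver H (relaxation H A) f).Nonempty ∧
    ∃ ε₀ : ℝ, 0 < ε₀ ∧ ∀ ε : ℝ, 0 < ε → ε ≤ ε₀ →
      ∀ μ ∈ argminOver H (relaxation H A) f, ∀ y : (s : V) → X s, IsTestLabeling H μ y →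
        (∃ ζ φ Φ, IsL1Solution H A (perturb H f y ε) y ζ φ Φ) ∧
        ∀ ζ φ Φ, IsL1Solution H A (perturb H f y ε) y ζ φ Φ →
          (∀ d x, ζ d x = 0 ∨ ζ d x = 1) ∧
          IsMaxSI H (relaxation H A) f
            (allToOneUnknown ∩ preserving H (relaxation H A)) (roundMap y ζ) ∧
          (allToOneUnknown ⊆ preserving H (relaxation H A) →
            IsMaxSI H (relaxation H A) f allToOneUnknown (roundMap y ζ)) ∧
          (∀ J : H.edges → H.edges → Prop, relaxation H A = localPolytope H J →
            IsMaxSI H (relaxation H A) f allToOneUnknown (roundMap y ζ)) := by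
  have hne := relaxation_nonempty hmarginal
  refine ⟨argminOver_nonempty hbounded hne f, ?_⟩
  choose δ hδ hδimp using exists_perturbation_bound hbounded hne f
  -- Taking the smallest bound over all pairs `(y, 𝒜)` makes the threshold independent of the
  -- choices of `μ` and `y`.
  obtain ⟨p₀, _, hp₀⟩ := Finset.exists_min_image
    (Finset.univ : Finset (((s : V) → X s) × Finset V)) (fun p => δ p.1 p.2)
    Finset.univ_nonempty
  refine ⟨δ p₀.1 p₀.2, hδ _ _, fun ε hε hle μ hμ y hy =>
    ⟨exists_isL1Solution hbounded hne _ y, fun ζ φ Φ hsol => ?_⟩⟩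
  have hζ := hsol.eq_intZeta hbounded hne
  set 𝒜 := moved y ζ
  have hround : roundMap y ζ = overwrite y 𝒜 := by rw [hζ, roundMap_intZeta]
  have hmax : IsMaxSI H (relaxation H A) f
      (allToOneUnknown ∩ preserving H (relaxation H A)) (roundMap y ζ) := by
    rw [hround]
    refine ⟨⟨⟨overwrite_mem_allToOneUnknown y 𝒜,
        fun μ hμ => (hsol.1.overwrite_moved hbounded hμ).1⟩,
      strictImproving_of_perturb hε fun μ hμ => (hsol.1.overwrite_moved hbounded hμ).2⟩,
      fun q hq hqs => ?_⟩
    -- Any competitor has target `y`, so its integral `ζ` is feasible for the same program and the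
    -- objectives can be compared.
    obtain ⟨ℬ, rfl⟩ := exists_eq_overwrite hnormalized hμ hy hq hqs
    obtain ⟨φ', Φ', hfeas⟩ := exists_l1Feasible_intZeta hbounded hne hq.2
      (hδimp y ℬ ε hε (hle.trans (hp₀ (y, ℬ) (Finset.mem_univ _))) hqs)
    have h1 := hsol.2 _ _ _ hfeas
    rw [hζ] at h1
    have h2 := l1Objective_intZeta_add_eliminated (H := H) (y := y) (𝒜 := 𝒜)
    have h3 := l1Objective_intZeta_add_eliminated (H := H) (y := y) (𝒜 := ℬ)
    have h4 : (eliminated (overwrite y ℬ) : ℝ) ≤ eliminated (overwrite y 𝒜) := by linarith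
    exact_mod_cast h4
  have hmax' : allToOneUnknown ⊆ preserving H (relaxation H A) →
      IsMaxSI H (relaxation H A) f allToOneUnknown (roundMap y ζ) := fun h => by
    rwa [Set.inter_eq_left.2 h] at hmax
  refine ⟨fun d x => ?_, hmax, hmax', fun J hJ => hmax' fun p _ => ?_⟩
  · rw [hζ, intZeta]
    split_ifs
    exacts [Or.inr rfl, Or.inl rfl]
  · rw [hJ]
    exact mem_preserving_localPolytope J p
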